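/- Let $d=3$, let $P_0=-\Delta$ on $\mathbb{R}^3$, let $$G_0=i\begin{pmatrix}0&1\\-P_0&0\end{pmatrix},$$ let $H^s$ ($s\in\mathbb{R}$) denote the usual Sobolev space on $\mathbb{R}^3$, let $\mathcal{H}^s:=H^{s+1}\oplus H^s$, and let $\langle x\rangle=(1+|x|^2)^{1/2}$. Let $k\ge 1$ be an integer, let $s\in\mathbb{R}$, and let $$\kappa=\begin{cases}1&\text{for }k=1,\\ k-\tfrac12&\text{for }k\ge 2.\end{cases}$$ For $z\in\mathbb{C}\setminus\mathbb{R}$ the operator $G_0-z$ is invertible on pairs of tempered distributions; $(G_0-z)^{-k}$ denotes the $k$-th power of its inverse. Then, for all $C,\varepsilon>0$, the operators $\langle x\rangle^{-\kappa-\varepsilon}(G_0-z)^{-k}\langle x\rangle^{-\kappa-\varepsilon}$, $z\in\mathbb{C}\setminus\mathbb{R}$, $|z|\le C$, are bounded from $\mathcal{H}^s$ to $\mathcal{H}^{s+k}$, and $$\sup_{z\in\mathbb{C}\setminus\mathbb{R},\ |z|\le C}\big\|\langle x\rangle^{-\kappa-\varepsilon}(G_0-z)^{-k}\langle x\rangle^{-\kappa-\varepsilon}\big\|_{\mathcal{L}(\mathcal{H}^s,\mathcal{H}^{s+k})}<\infty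 .$$ -/

import Mathlib

open MeasureTheory TemperedDistribution
open scoped SchwartzMap Laplacian

noncomputable section

namespace FreeWave

/-- Three-dimensional Euclidean space. -/
abbrev R3 : Type := EuclideanSpace ℝ (Fin 3)

/-- Complex-valued tempered distributions on `ℝ³`. -/
abbrev Dist : Type := 𝓢'(R3, ℂ)

/-- The Sobolev space `H^s(ℝ³)` as a linear subspace of the tempered distributions: those `f` for
which `⟨D⟩^s f` is (represented by) an `L²` function. -/
def sobolevSubmodule (s : ℝ) : Submodule ℂ Dist where
  carrier := {f | MemSobolev s 2 f}
  add_mem' := fun hf hg => MemSobolev.add hf hg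
  zero_mem' := memSobolev_fun_zero R3 ℂ s 2
  smul_mem' := fun c _ hf => MemSobolev.smul c hf

/-- The Sobolev space `H^s(ℝ³)`, a copy of `sobolevSubmodule s` that carries the Sobolev norm
(below) instead of the topology induced by the tempered distributions. -/
def SobolevSpace (s : ℝ) : Type := sobolevSubmodule s

instance (s : ℝ) : AddCommGroup (SobolevSpace s) :=
  inferInstanceAs (AddCommGroup (sobolevSubmodule s))

instance (s : ℝ) : Module ℂ (SobolevSpace s) :=
  inferInstanceAs (Module ℂ (sobolevSubmodule s))

/-- The inclusion of `H^s` into the tempered distributions. -/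
def SobolevSpace.incl (s : ℝ) : SobolevSpace s →ₗ[ℂ] Dist := (sobolevSubmodule s).subtype

theorem SobolevSpace.incl_injective (s : ℝ) : Function.Injective (SobolevSpace.incl s) :=
  Subtype.val_injective

theorem toDist_injective : Function.Injective
    (Lp.toTemperedDistributionCLM ℂ (volume : Measure R3) 2 : Lp ℂ 2 (volume : Measure R3) → Dist) :=
  LinearMap.ker_eq_bot.mp
    (Lp.ker_toTemperedDistributionCLM_eq_bot (F := ℂ) (μ := (volume : Measure R3)) (p := 2))

/-- The `L²` function `⟨D⟩^s f` attached to `f ∈ H^s`. -/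
def SobolevSpace.besselFun {s : ℝ} (f : SobolevSpace s) : Lp ℂ 2 (volume : Measure R3) :=
  Classical.choose f.2

theorem SobolevSpace.besselFun_spec {s : ℝ} (f : SobolevSpace s) :
    Lp.toTemperedDistributionCLM ℂ (volume : Measure R3) 2 f.besselFun =
      besselPotential R3 ℂ s (SobolevSpace.incl s f) :=
  (Classical.choose_spec f.2).symm

/-- The linear map `f ↦ ⟨D⟩^s f` from `H^s` to `L²`. -/
def SobolevSpace.toL2 (s : ℝ) : SobolevSpace s →ₗ[ℂ] Lp ℂ 2 (volume : Measure R3) where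
  toFun f := f.besselFun
  map_add' f g := toDist_injective (by simp only [map_add, SobolevSpace.besselFun_spec])
  map_smul' c f := toDist_injective (by
    simp only [map_smul, SobolevSpace.besselFun_spec, RingHom.id_apply])

theorem SobolevSpace.toL2_injective (s : ℝ) : Function.Injective (SobolevSpace.toL2 s) := by
  intro f g h
  have h1 : besselPotential R3 ℂ s (SobolevSpace.incl s f) =
      besselPotential R3 ℂ s (SobolevSpace.incl s g) := by
    rw [← SobolevSpace.besselFun_spec, ← SobolevSpace.besselFun_spec]
    exact congrArg _ h
  have h2 := congrArg (besselPotential R3 ℂ (-s)) h1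
  simp only [besselPotential_besselPotential_apply, add_neg_cancel, besselPotential_zero,
    ContinuousLinearMap.id_apply] at h2
  exact SobolevSpace.incl_injective s h2

/-- The Sobolev norm `‖f‖_{H^s} = ‖⟨D⟩^s f‖_{L²}`. -/
instance (s : ℝ) : NormedAddCommGroup (SobolevSpace s) :=
  NormedAddCommGroup.induced _ _ (SobolevSpace.toL2 s) (SobolevSpace.toL2_injective s)

instance (s : ℝ) : NormedSpace ℂ (SobolevSpace s) :=
  NormedSpace.induced ℂ _ _ (SobolevSpace.toL2 s)

/-- The space `𝓗^s = H^{s+1} ⊕ H^s` with its direct sum Hilbert norm. -/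
abbrev HSpace (s : ℝ) : Type := WithLp 2 (SobolevSpace (s + 1) × SobolevSpace s)

/-- The inclusion of `𝓗^s` into pairs of tempered distributions. -/
def HSpace.incl (s : ℝ) (u : HSpace s) : Dist × Dist :=
  (SobolevSpace.incl (s + 1) u.fst, SobolevSpace.incl s u.snd)

/-- The free wave generator `G₀ = i (0, 1; -P₀, 0)` with `P₀ = -Δ`, acting on pairs of tempered
distributions: `G₀ (u, v) = (i v, i Δ u)`. -/
def G0 : Dist × Dist →L[ℂ] Dist × Dist :=
  (Complex.I • ContinuousLinearMap.snd ℂ Dist Dist).prod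
    (Complex.I • ((-(-LineDeriv.laplacianCLM ℂ R3 Dist)).comp
      (ContinuousLinearMap.fst ℂ Dist Dist)))

/-- The free resolvent `(G₀ - z)⁻¹`, the two-sided inverse of `G₀ - z` on pairs of tempered
distributions. -/
def freeResolvent (z : ℂ) : Dist × Dist →L[ℂ] Dist × Dist :=
  Ring.inverse (G0 - z • (1 : Dist × Dist →L[ℂ] Dist × Dist))

/-- Multiplication of both components by `⟨x⟩^a`, where `⟨x⟩ = (1 + |x|²)^{1/2}`. -/
def weight (a : ℝ) : Dist × Dist →L[ℂ] Dist × Dist :=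
  (smulLeftCLM ℂ (fun x : R3 => (((1 + ‖x‖ ^ 2) ^ (a / 2) : ℝ) : ℂ))).prodMap
    (smulLeftCLM ℂ (fun x : R3 => (((1 + ‖x‖ ^ 2) ^ (a / 2) : ℝ) : ℂ)))

/-- The exponent `κ`: `1` for `k = 1` and `k - 1/2` for `k ≥ 2`. -/
def kappa (k : ℕ) : ℝ := if k = 1 then 1 else (k : ℝ) - 1 / 2

end FreeWave

end

/-! Since `G0` squares to `-Δ`, every function of `G0` has the form `d(D) + o(D) G0`, where `d` and
`o(λ)λ` are the even and odd parts in `λ = 2π|ξ|`. For `(G0 - z)^{-(n+1)}` they are `diagSym n z`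
and `offSym n z`, both built from `powSym`, and `freeResolvent_pow` identifies the matrix on pairs
of tempered distributions. It remains to bound the entries with symbols `diagSym`, `offSym` and
`lamSq * offSym` between Sobolev spaces, with gains `n + 1`, `n + 2` and `n`.

Uniformity up to the real axis comes from explicit kernels. For `Im z > 0`, differentiating the
Fourier transform of `e^{izr}/r` in `z` shows that `powSym (j+1)` is convolution with a constant
times `r^{j-1} e^{izr}` (`fourier_kern`). The exponential has modulus at most one and may be
dropped. The weighted kernel `⟨x⟩^{-a} |x-y|^{j-1} ⟨y⟩^{-a}` is Hilbert–Schmidt when `a > 1` and `a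
> j + 1/2` (`exists_lintegral_wKern_le`). With `j = n = k - 1` this gives `κ = max(1, k - 1/2)`. The
lower half-plane follows by parity in `z`.

This gives `L²` bounds without gain of derivatives. The gain comes from high frequencies: for `|ξ| ≥
C + 1` and `|z| ≤ C` the denominator `λ² - z²` is elliptic and the symbols decay as required
(`exists_norm_powSym_le`). In `exists_nm_sobolev_le` a frequency cutoff joins the two regimes. The
low part uses that cutoffs smooth in weighted spaces (`exists_nm_low_le` and its dual), the high
part that `⟨x⟩^{-a}` acts boundedly on every Sobolev space (`exists_nm_weight_le`). All estimates
are made on Schwartz functions and extended by density (`exists_L2_operator`). -/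

noncomputable section

namespace FreeWave

open FourierTransform
open scoped ENNReal

/-! ### Multiplication operators and Fourier multipliers on Schwartz functions -/

/-- The Japanese bracket power `⟨x⟩^s`. -/
def jap (s : ℝ) (x : R3) : ℂ := (((1 + ‖x‖ ^ 2) ^ (s / 2) : ℝ) : ℂ)

@[fun_prop]
theorem hasTemperateGrowth_jap (s : ℝ) : (jap s).HasTemperateGrowth := by
  unfold jap; fun_prop

theorem jap_mul_jap (s t : ℝ) : jap s * jap t = jap (s + t) := by
  ext x
  simp only [jap, Pi.mul_apply]
  rw [← Complex.ofReal_mul, ← Real.rpow_add (by positivity)]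
  congr 2; ring

theorem jap_zero : jap 0 = fun _ => 1 := by ext x; simp [jap]

theorem norm_jap (s : ℝ) (x : R3) : ‖jap s x‖ = (1 + ‖x‖ ^ 2) ^ (s / 2) := by
  rw [jap, Complex.norm_real, Real.norm_of_nonneg (by positivity)]

/-- Multiplication of a Schwartz function by `g`. -/
abbrev mulOp (g : R3 → ℂ) : 𝓢(R3, ℂ) →L[ℂ] 𝓢(R3, ℂ) := SchwartzMap.smulLeftCLM ℂ g

/-- The Fourier multiplier with symbol `g` on Schwartz functions. -/
abbrev multOp (g : R3 → ℂ) : 𝓢(R3, ℂ) →L[ℂ] 𝓢(R3, ℂ) := SchwartzMap.fourierMultiplierCLM ℂ g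

theorem mulOp_apply {g : R3 → ℂ} (hg : g.HasTemperateGrowth) (f : 𝓢(R3, ℂ)) (x : R3) :
    mulOp g f x = g x * f x := by
  simp [mulOp, SchwartzMap.smulLeftCLM_apply_apply hg]

theorem mulOp_mulOp {g h : R3 → ℂ} (hg : g.HasTemperateGrowth) (hh : h.HasTemperateGrowth)
    (f : 𝓢(R3, ℂ)) : mulOp g (mulOp h f) = mulOp (g * h) f :=
  SchwartzMap.smulLeftCLM_smulLeftCLM_apply hg hh f

theorem multOp_multOp {g h : R3 → ℂ} (hg : g.HasTemperateGrowth) (hh : h.HasTemperateGrowth)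
    (f : 𝓢(R3, ℂ)) : multOp g (multOp h f) = multOp (g * h) f :=
  SchwartzMap.fourierMultiplierCLM_fourierMultiplierCLM_apply hg hh f

theorem multOp_eq (g : R3 → ℂ) (f : 𝓢(R3, ℂ)) : multOp g f = 𝓕⁻ (mulOp g (𝓕 f)) := rfl

theorem mulOp_jap_jap (s t : ℝ) (f : 𝓢(R3, ℂ)) : mulOp (jap s) (mulOp (jap t) f) =
    mulOp (jap (s + t)) f := by
  rw [mulOp_mulOp (by fun_prop) (by fun_prop), jap_mul_jap]

theorem multOp_jap_jap (s t : ℝ) (f : 𝓢(R3, ℂ)) : multOp (jap s) (multOp (jap t) f) =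
    multOp (jap (s + t)) f := by
  rw [multOp_multOp (by fun_prop) (by fun_prop), jap_mul_jap]

theorem mulOp_jap_zero (f : 𝓢(R3, ℂ)) : mulOp (jap 0) f = f := by
  rw [jap_zero]; simp [mulOp]

theorem multOp_jap_zero (f : 𝓢(R3, ℂ)) : multOp (jap 0) f = f := by
  rw [jap_zero]; simp [multOp]

/-! ### `L²` norms of Schwartz functions -/

/-- The `L²` norm of a Schwartz function. -/
def nm (f : 𝓢(R3, ℂ)) : ℝ := ‖f.toLp 2 (volume : Measure R3)‖

theorem nm_nonneg (f : 𝓢(R3, ℂ)) : 0 ≤ nm f := norm_nonneg _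

theorem nm_fourier (f : 𝓢(R3, ℂ)) : nm (𝓕 f) = nm f := SchwartzMap.norm_fourier_toL2_eq f

theorem nm_fourierInv (f : 𝓢(R3, ℂ)) : nm (𝓕⁻ f) = nm f := by
  rw [← nm_fourier (𝓕⁻ f)]; simp

theorem toLp_add (f g : 𝓢(R3, ℂ)) : (f + g).toLp 2 (volume : Measure R3) =
    f.toLp 2 (volume : Measure R3) + g.toLp 2 (volume : Measure R3) :=
  (SchwartzMap.toLpCLM ℂ ℂ 2 (volume : Measure R3)).map_add f g

theorem toLp_smul (c : ℂ) (f : 𝓢(R3, ℂ)) : (c • f).toLp 2 (volume : Measure R3) =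
    c • f.toLp 2 (volume : Measure R3) :=
  (SchwartzMap.toLpCLM ℂ ℂ 2 (volume : Measure R3)).map_smul c f

theorem nm_add_le (f g : 𝓢(R3, ℂ)) : nm (f + g) ≤ nm f + nm g := by
  rw [nm, toLp_add]; exact norm_add_le _ _

theorem nm_smul (c : ℂ) (f : 𝓢(R3, ℂ)) : nm (c • f) = ‖c‖ * nm f := by
  rw [nm, toLp_smul, norm_smul]; rfl

theorem nm_neg (f : 𝓢(R3, ℂ)) : nm (-f) = nm f := by
  rw [← neg_one_smul ℂ f, nm_smul]; simp

theorem nm_sub_le (f g : 𝓢(R3, ℂ)) : nm (f - g) ≤ nm f + nm g := by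
  rw [sub_eq_add_neg, ← nm_neg g]; exact nm_add_le _ _

theorem ofReal_nm_sq (f : 𝓢(R3, ℂ)) : ENNReal.ofReal (nm f) ^ 2 = ∫⁻ x, ‖f x‖ₑ ^ 2 := by
  rw [nm, ofReal_norm, Lp.enorm_def]
  rw [eLpNorm_congr_ae (f.coeFn_toLp 2 volume),
    eLpNorm_eq_lintegral_rpow_enorm_toReal (by norm_num) (by norm_num),
    ← ENNReal.rpow_natCast, ← ENNReal.rpow_mul]
  norm_num

theorem nm_le_of_lintegral {f g : 𝓢(R3, ℂ)} {A : ℝ} (hA : 0 ≤ A)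
    (h : ∫⁻ x, ‖f x‖ₑ ^ 2 ≤ ENNReal.ofReal A ^ 2 * ∫⁻ x, ‖g x‖ₑ ^ 2) : nm f ≤ A * nm g := by
  rw [← ofReal_nm_sq, ← ofReal_nm_sq, ← mul_pow, ← ENNReal.ofReal_mul hA] at h
  have := (ENNReal.pow_le_pow_left_iff (two_ne_zero)).1 h
  exact (ENNReal.ofReal_le_ofReal_iff (mul_nonneg hA (nm_nonneg g))).1 this

theorem nm_le_of_norm_le {f g : 𝓢(R3, ℂ)} {A : ℝ} (hA : 0 ≤ A)
    (h : ∀ x, ‖f x‖ ≤ A * ‖g x‖) : nm f ≤ A * nm g := by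
  apply nm_le_of_lintegral hA
  rw [← lintegral_const_mul _ (by fun_prop)]
  refine lintegral_mono fun x => ?_
  rw [← mul_pow]
  gcongr
  rw [← ofReal_norm, ← ofReal_norm, ← ENNReal.ofReal_mul hA]
  exact ENNReal.ofReal_le_ofReal (h x)

theorem nm_mulOp_le {g : R3 → ℂ} (hg : g.HasTemperateGrowth) {A : ℝ} (hA : 0 ≤ A)
    (h : ∀ x, ‖g x‖ ≤ A) (f : 𝓢(R3, ℂ)) : nm (mulOp g f) ≤ A * nm f := by
  refine nm_le_of_norm_le hA fun x => ?_
  rw [mulOp_apply hg, norm_mul]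
  gcongr; exact h x

theorem nm_multOp (g : R3 → ℂ) (f : 𝓢(R3, ℂ)) : nm (multOp g f) = nm (mulOp g (𝓕 f)) := by
  rw [multOp_eq, nm_fourierInv]

theorem nm_multOp_le {g : R3 → ℂ} (hg : g.HasTemperateGrowth) {A : ℝ} (hA : 0 ≤ A)
    (h : ∀ x, ‖g x‖ ≤ A) (f : 𝓢(R3, ℂ)) : nm (multOp g f) ≤ A * nm f := by
  rw [nm_multOp, ← nm_fourier f]; exact nm_mulOp_le hg hA h _

theorem nm_multOp_jap_le {s t : ℝ} (hst : s ≤ t) (f : 𝓢(R3, ℂ)) :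
    nm (multOp (jap s) f) ≤ nm (multOp (jap t) f) := by
  have : multOp (jap s) f = multOp (jap (s - t)) (multOp (jap t) f) := by
    rw [multOp_jap_jap, sub_add_cancel]
  rw [this, ← one_mul (nm (multOp (jap t) f))]
  refine nm_multOp_le (by fun_prop) zero_le_one (fun x => ?_) _
  rw [norm_jap]
  exact Real.rpow_le_one_of_one_le_of_nonpos (by nlinarith [norm_nonneg x]) (by linarith)

/-! ### Integral operators -/

theorem lintegral_mul_sq_le {α : Type*} [MeasurableSpace α] {μ : Measure α} {f g : α → ℝ≥0∞}
    (hf : AEMeasurable f μ) (hg : AEMeasurable g μ) :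
    (∫⁻ x, f x * g x ∂μ) ^ 2 ≤ (∫⁻ x, f x ^ 2 ∂μ) * ∫⁻ x, g x ^ 2 ∂μ := by
  have h := ENNReal.lintegral_mul_le_Lp_mul_Lq μ (Real.HolderConjugate.two_two) hf hg
  calc _ ≤ ((∫⁻ x, f x ^ (2:ℝ) ∂μ) ^ (1 / (2:ℝ)) * (∫⁻ x, g x ^ (2:ℝ) ∂μ) ^ (1 / (2:ℝ))) ^ 2 := by
        gcongr; exact h
    _ = _ := by
      rw [mul_pow, ← ENNReal.rpow_natCast, ← ENNReal.rpow_mul, ← ENNReal.rpow_natCast,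
        ← ENNReal.rpow_mul]
      norm_num

/-- Cauchy–Schwarz in `y` for each fixed `x`. The resolvent kernels are estimated through this. -/
theorem nm_le_of_hilbertSchmidt {f g : 𝓢(R3, ℂ)} {K : R3 → R3 → ℝ≥0∞} {A : ℝ} (hA : 0 ≤ A)
    (hK : ∀ x, AEMeasurable (K x))
    (hKA : ∫⁻ x, ∫⁻ y, K x y ^ 2 ≤ ENNReal.ofReal A ^ 2)
    (h : ∀ x, ‖f x‖ₑ ≤ ∫⁻ y, K x y * ‖g y‖ₑ) : nm f ≤ A * nm g := by
  apply nm_le_of_lintegral hA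
  calc ∫⁻ x, ‖f x‖ₑ ^ 2 ≤ ∫⁻ x, (∫⁻ y, K x y ^ 2) * ∫⁻ y, ‖g y‖ₑ ^ 2 := by
        refine lintegral_mono fun x => ?_
        refine (pow_le_pow_left' (h x) 2).trans ?_
        exact lintegral_mul_sq_le (hK x) (by fun_prop)
    _ = (∫⁻ x, ∫⁻ y, K x y ^ 2) * ∫⁻ y, ‖g y‖ₑ ^ 2 :=
        lintegral_mul_const' _ _ (by rw [← ofReal_nm_sq]; finiteness)
    _ ≤ _ := by gcongr

/-- Young's inequality `L¹ * L² ⊂ L²`: write `V = V^{1/2} V^{1/2}`, apply Cauchy–Schwarz, then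
Tonelli and translation invariance. -/
theorem nm_le_of_convolution {f g : 𝓢(R3, ℂ)} {V : R3 → ℝ≥0∞} {A : ℝ} (hA : 0 ≤ A)
    (hV : Measurable V) (hVA : ∫⁻ y, V y ≤ ENNReal.ofReal A)
    (h : ∀ x, ‖f x‖ₑ ≤ ∫⁻ y, V y * ‖g (x - y)‖ₑ) : nm f ≤ A * nm g := by
  apply nm_le_of_lintegral hA
  have hgm : Measurable g := g.continuous.measurable
  have hg : Measurable fun p : R3 × R3 => ‖g (p.1 - p.2)‖ₑ := by fun_prop
  have key : ∀ x, ‖f x‖ₑ ^ 2 ≤ (∫⁻ y, V y) * ∫⁻ y, V y * ‖g (x - y)‖ₑ ^ 2 := by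
    intro x
    refine (pow_le_pow_left' (h x) 2).trans ?_
    have h1 : ∀ y, V y * ‖g (x - y)‖ₑ = V y ^ (1/2:ℝ) * (V y ^ (1/2:ℝ) * ‖g (x - y)‖ₑ) := by
      intro y
      rw [← mul_assoc, ← ENNReal.rpow_add_of_nonneg _ _ (by norm_num) (by norm_num)]
      norm_num
    have h2 : ∀ a : ℝ≥0∞, (a ^ (1/2:ℝ)) ^ 2 = a := by
      intro a
      rw [← ENNReal.rpow_natCast, ← ENNReal.rpow_mul]; norm_num
    simp_rw [h1]
    refine (lintegral_mul_sq_le (by fun_prop) (by fun_prop)).trans ?_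
    simp_rw [mul_pow, h2]
    rfl
  calc ∫⁻ x, ‖f x‖ₑ ^ 2 ≤ ∫⁻ x, (∫⁻ y, V y) * ∫⁻ y, V y * ‖g (x - y)‖ₑ ^ 2 := lintegral_mono key
    _ = (∫⁻ y, V y) * ∫⁻ x, ∫⁻ y, V y * ‖g (x - y)‖ₑ ^ 2 :=
        lintegral_const_mul' _ _ (ne_top_of_le_ne_top ENNReal.ofReal_ne_top hVA)
    _ = (∫⁻ y, V y) * ∫⁻ y, ∫⁻ x, V y * ‖g (x - y)‖ₑ ^ 2 := by
        rw [lintegral_lintegral_swap]; fun_prop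
    _ = (∫⁻ y, V y) * ∫⁻ y, V y * ∫⁻ x, ‖g x‖ₑ ^ 2 := by
        congr 1
        refine lintegral_congr fun y => ?_
        rw [lintegral_const_mul _ (by fun_prop), lintegral_sub_right_eq_self (fun x => ‖g x‖ₑ ^ 2)]
    _ = (∫⁻ y, V y) * ((∫⁻ y, V y) * ∫⁻ x, ‖g x‖ₑ ^ 2) := by
        rw [lintegral_mul_const _ hV]
    _ ≤ _ := by rw [← mul_assoc, pow_two]; gcongr

/-! ### Multipliers as convolutions on weighted `L²` -/

/-- A Fourier multiplier whose symbol is the Fourier transform of an integrable function is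
convolution with that function. -/
theorem multOp_apply_eq_integral {h : R3 → ℂ} (hh : Integrable h) {Q : R3 → ℂ}
    (hQ : Q.HasTemperateGrowth) (hQh : ∀ ξ, 𝓕 h ξ = Q ξ) (φ : 𝓢(R3, ℂ)) (x : R3) :
    multOp Q φ x = ∫ y, h y * φ (x - y) := by
  have e1 : multOp Q φ x = ∫ ξ, 𝓕 h ξ * (Real.fourierChar (inner ℝ ξ x) • 𝓕 φ ξ) := by
    rw [multOp_eq, SchwartzMap.fourierInv_coe, Real.fourierInv_eq]
    refine integral_congr_ae (.of_forall fun ξ => ?_)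
    simp only
    rw [mulOp_apply hQ, hQh, Circle.smul_def, Circle.smul_def]
    simp only [smul_eq_mul]; ring
  have hint : Integrable fun ξ => Real.fourierChar (inner ℝ ξ x) • 𝓕 φ ξ := by
    have : Integrable (fun ξ => (𝓕 φ) ξ) := (𝓕 φ).integrable
    refine this.mono ?_ (.of_forall fun ξ => ?_)
    · refine Continuous.aestronglyMeasurable ?_
      have : Continuous fun ξ => Real.fourierChar (inner ℝ ξ x) :=
        Real.continuous_fourierChar.comp (by fun_prop)
      exact this.smul (𝓕 φ).continuous
    · rw [Circle.smul_def, norm_smul, Circle.norm_coe, one_mul]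
  -- The multiplication formula moves the Fourier transform from `h` to the modulated `𝓕 φ`, where
  -- it becomes inversion at `x - y`.
  have e2 := VectorFourier.integral_fourierIntegral_smul_eq_flip (μ := (volume : Measure R3))
    (ν := (volume : Measure R3)) (L := innerₗ R3) (f := h)
    (g := fun ξ => Real.fourierChar (inner ℝ ξ x) • 𝓕 φ ξ) Real.continuous_fourierChar
    (by simp only [innerₗ_apply_apply]; fun_prop) hh hint
  have e3 : ∀ y, VectorFourier.fourierIntegral Real.fourierChar (volume : Measure R3)
      (innerₗ R3).flip (fun ξ => Real.fourierChar (inner ℝ ξ x) • 𝓕 φ ξ) y = φ (x - y) := by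
    intro y
    have : φ (x - y) = 𝓕⁻ (𝓕 φ) (x - y) := by simp
    rw [this, SchwartzMap.fourierInv_coe, Real.fourierInv_eq, VectorFourier.fourierIntegral]
    refine integral_congr_ae (.of_forall fun ξ => ?_)
    simp only [LinearMap.flip_apply, innerₗ_apply_apply]
    rw [smul_smul, ← AddChar.map_add_eq_mul, inner_sub_right, real_inner_comm y ξ]
    congr 2; ring
  rw [e1]
  refine Eq.trans ?_ (e2.trans ?_)
  · rfl
  · simp_rw [e3, smul_eq_mul]

/-- Peetre's inequality. -/
theorem norm_jap_mul_le (s : ℝ) (x y : R3) :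
    ‖jap s x‖ * ‖jap (-s) (x - y)‖ ≤ 2 ^ (|s| / 2) * ‖jap |s| y‖ := by
  simp only [norm_jap]
  have h1 : 1 + ‖x‖ ^ 2 ≤ 2 * (1 + ‖x - y‖ ^ 2) * (1 + ‖y‖ ^ 2) := by
    have : ‖x‖ ≤ ‖x - y‖ + ‖y‖ := by simpa using norm_add_le (x - y) y
    nlinarith [norm_nonneg x, norm_nonneg y, norm_nonneg (x - y), sq_nonneg (‖x - y‖ - ‖y‖),
      mul_nonneg (sq_nonneg ‖x - y‖) (sq_nonneg ‖y‖)]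
  have h2 : 1 + ‖x - y‖ ^ 2 ≤ 2 * (1 + ‖x‖ ^ 2) * (1 + ‖y‖ ^ 2) := by
    have : ‖x - y‖ ≤ ‖x‖ + ‖y‖ := norm_sub_le x y
    nlinarith [norm_nonneg x, norm_nonneg y, norm_nonneg (x - y), sq_nonneg (‖x‖ - ‖y‖),
      mul_nonneg (sq_nonneg ‖x‖) (sq_nonneg ‖y‖)]
  have p0 : (0:ℝ) < 1 + ‖x‖ ^ 2 := by positivity
  have p1 : (0:ℝ) < 1 + ‖x - y‖ ^ 2 := by positivity
  have p2 : (0:ℝ) < 1 + ‖y‖ ^ 2 := by positivity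
  rw [← Real.mul_rpow (by norm_num) p2.le]
  rcases le_total 0 s with hs | hs
  · rw [abs_of_nonneg hs, show -s / 2 = -(s / 2) by ring, Real.rpow_neg p1.le,
      ← div_eq_mul_inv, ← Real.div_rpow p0.le p1.le]
    refine Real.rpow_le_rpow (by positivity) ?_ (by linarith)
    rw [div_le_iff₀ p1]; linarith
  · rw [abs_of_nonpos hs, show s / 2 = -(-s / 2) by ring, Real.rpow_neg p0.le, mul_comm,
      ← div_eq_mul_inv, ← Real.div_rpow p1.le p0.le]
    refine Real.rpow_le_rpow (by positivity) ?_ (by linarith)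
    rw [div_le_iff₀ p0]; linarith

/-- Multipliers with rapidly decaying convolution kernel are bounded on weighted `L²`. -/
theorem exists_nm_jap_multOp_jap_le {h : R3 → ℂ} (hm : Measurable h) (s : ℝ)
    (hh : ∫⁻ y, ‖h y‖ₑ * ‖jap |s| y‖ₑ < ∞) {Q : R3 → ℂ}
    (hQ : Q.HasTemperateGrowth) (hQh : ∀ ξ, 𝓕 h ξ = Q ξ) :
    ∃ A : ℝ, 0 ≤ A ∧ ∀ φ : 𝓢(R3, ℂ),
      nm (mulOp (jap s) (multOp Q (mulOp (jap (-s)) φ))) ≤ A * nm φ := by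
  have hj : ∀ y : R3, (1:ℝ) ≤ ‖jap |s| y‖ := fun y => by
    rw [norm_jap]
    exact Real.one_le_rpow (by nlinarith [norm_nonneg y]) (by positivity)
  have hhi : Integrable h := by
    refine ⟨hm.aestronglyMeasurable, lt_of_le_of_lt (lintegral_mono fun y => ?_) hh⟩
    rw [← ofReal_norm (jap |s| y)]
    exact le_mul_of_one_le_right' (by simpa using ENNReal.ofReal_le_ofReal (hj y))
  have mj : ∀ s, Measurable (jap s) := fun s => (hasTemperateGrowth_jap s).1.continuous.measurable
  set V : R3 → ℝ≥0∞ := fun y => ENNReal.ofReal (2 ^ (|s| / 2)) * (‖h y‖ₑ * ‖jap |s| y‖ₑ) with hV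
  have hVm : Measurable V := by
    have := mj |s|
    fun_prop
  have hVA : ∫⁻ y, V y < ∞ := by
    rw [hV, lintegral_const_mul' _ _ ENNReal.ofReal_ne_top]
    exact ENNReal.mul_lt_top ENNReal.ofReal_lt_top hh
  refine ⟨(∫⁻ y, V y).toReal, ENNReal.toReal_nonneg, fun φ => ?_⟩
  refine nm_le_of_convolution ENNReal.toReal_nonneg hVm
    (by rw [ENNReal.ofReal_toReal hVA.ne]) fun x => ?_
  rw [mulOp_apply (by fun_prop), multOp_apply_eq_integral hhi hQ hQh, ← integral_const_mul]
  refine (enorm_integral_le_lintegral_enorm _).trans (lintegral_mono fun y => ?_)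
  rw [mulOp_apply (by fun_prop), hV]
  simp only [enorm_mul]
  have := norm_jap_mul_le s x y
  have h3 : ‖jap s x‖ₑ * ‖jap (-s) (x - y)‖ₑ ≤ ENNReal.ofReal (2 ^ (|s| / 2)) * ‖jap |s| y‖ₑ := by
    rw [← ofReal_norm, ← ofReal_norm, ← ofReal_norm, ← ENNReal.ofReal_mul (by positivity),
      ← ENNReal.ofReal_mul (by positivity)]
    exact ENNReal.ofReal_le_ofReal this
  calc _ = (‖jap s x‖ₑ * ‖jap (-s) (x - y)‖ₑ) * ‖h y‖ₑ * ‖φ (x - y)‖ₑ := by ring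
    _ ≤ (ENNReal.ofReal (2 ^ (|s| / 2)) * ‖jap |s| y‖ₑ) * ‖h y‖ₑ * ‖φ (x - y)‖ₑ := by gcongr
    _ = _ := by ring

/-! ### Symmetry of real multipliers -/

/-- The `L²` inner product of Schwartz functions. -/
def ip (f g : 𝓢(R3, ℂ)) : ℂ := inner ℂ (f.toLp 2 (volume : Measure R3)) (g.toLp 2 volume)

theorem ip_fourier (f g : 𝓢(R3, ℂ)) : ip (𝓕 f) (𝓕 g) = ip f g :=
  SchwartzMap.inner_fourier_toL2_eq f g

theorem ip_self (f : 𝓢(R3, ℂ)) : ip f f = ((nm f ^ 2 : ℝ) : ℂ) := by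
  rw [ip, inner_self_eq_norm_sq_to_K]; simp [nm]

theorem norm_ip_le (f g : 𝓢(R3, ℂ)) : ‖ip f g‖ ≤ nm f * nm g := norm_inner_le_norm _ _

theorem ip_eq_integral (f g : 𝓢(R3, ℂ)) : ip f g = ∫ x, inner ℂ (f x) (g x) :=
  SchwartzMap.inner_toL2_toL2_eq f g volume

theorem ip_mulOp {g : R3 → ℂ} (hg : g.HasTemperateGrowth)
    (hr : ∀ x, (starRingEnd ℂ) (g x) = g x) (f u : 𝓢(R3, ℂ)) :
    ip (mulOp g f) u = ip f (mulOp g u) := by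
  rw [ip_eq_integral, ip_eq_integral]
  refine integral_congr_ae (.of_forall fun x => ?_)
  simp only [mulOp_apply hg, RCLike.inner_apply, map_mul, hr]
  ring

theorem ip_multOp {g : R3 → ℂ} (hg : g.HasTemperateGrowth)
    (hr : ∀ x, (starRingEnd ℂ) (g x) = g x) (f u : 𝓢(R3, ℂ)) :
    ip (multOp g f) u = ip f (multOp g u) := by
  rw [← ip_fourier, ← ip_fourier f, multOp_eq, multOp_eq]
  simpa using ip_mulOp hg hr (𝓕 f) (𝓕 u)

theorem conj_jap (s : ℝ) (x : R3) : (starRingEnd ℂ) (jap s x) = jap s x := Complex.conj_ofReal _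

/-- A bound for an operator follows from the same bound for its formal adjoint. -/
theorem nm_le_of_adjoint {T T' : 𝓢(R3, ℂ) → 𝓢(R3, ℂ)} (hT : ∀ f g, ip (T f) g = ip f (T' g))
    {A : ℝ} (h : ∀ f, nm (T' f) ≤ A * nm f) (f : 𝓢(R3, ℂ)) : nm (T f) ≤ A * nm f := by
  rcases (nm_nonneg (T f)).eq_or_lt with h0 | h0
  · rw [← h0]
    -- `A` has no sign assumption; `0 ≤ A * nm f` follows from the hypothesis on `T'`.
    by_contra! hc
    have h1 := h f
    linarith [nm_nonneg (T' f)]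
  · have h1 : nm (T f) ^ 2 ≤ nm f * (A * nm (T f)) := by
      have e : ‖ip (T f) (T f)‖ = nm (T f) ^ 2 := by
        rw [ip_self, Complex.norm_real, Real.norm_of_nonneg (sq_nonneg _)]
      rw [← e, hT]
      exact (norm_ip_le _ _).trans (mul_le_mul_of_nonneg_left (h _) (nm_nonneg f))
    have : nm (T f) * nm (T f) ≤ (A * nm f) * nm (T f) := by linarith
    exact le_of_mul_le_mul_right this h0

/-! ### Multiplication by weights on Sobolev spaces -/

theorem exists_one_add_rpow_le_exp (p c : ℝ) (hc : 0 < c) :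
    ∃ K : ℝ, 0 ≤ K ∧ ∀ u : ℝ, 0 ≤ u → (1 + u) ^ p ≤ K * Real.exp (c * u) := by
  obtain ⟨n, hn⟩ := exists_nat_ge (max p 1)
  have hn1 : (1:ℝ) ≤ n := (le_max_right _ _).trans hn
  have hn0 : (0:ℝ) < n := by linarith
  -- From `1 + v ≤ e^v` with `v = cu/n` one gets `1 + u ≤ K e^v`; the `n`-th power of this is the
  -- claim.
  set K : ℝ := max 1 (n / c)
  have hK1 : 1 ≤ K := le_max_left _ _
  have hK2 : n / c ≤ K := le_max_right _ _
  refine ⟨K ^ n, by positivity, fun u hu => ?_⟩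
  have h1 : 1 + u ≤ K * Real.exp (c * u / n) := by
    have h2 : c * u / n + 1 ≤ Real.exp (c * u / n) := Real.add_one_le_exp _
    have h3 : u ≤ K * (c * u / n) := by
      calc u = (n / c) * (c * u / n) := by field_simp
        _ ≤ _ := by gcongr
    nlinarith
  calc (1 + u) ^ p ≤ (1 + u) ^ (n:ℝ) :=
        Real.rpow_le_rpow_of_exponent_le (by linarith) ((le_max_left _ _).trans hn)
    _ = (1 + u) ^ n := Real.rpow_natCast _ _
    _ ≤ (K * Real.exp (c * u / n)) ^ n := by gcongr
    _ = _ := by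
      rw [mul_pow, ← Real.exp_nat_mul]
      congr 2; field_simp

/-- For an even weight `𝓕` and `𝓕⁻` can be exchanged, so boundedness of a weight on Sobolev spaces
becomes boundedness of a multiplier on weighted `L²`. -/
theorem fourier_mulOp_fourierInv {w : R3 → ℂ} (hw : w.HasTemperateGrowth)
    (he : ∀ x, w (-x) = w x) (ρ : 𝓢(R3, ℂ)) : 𝓕 (mulOp w (𝓕⁻ ρ)) = multOp w ρ := by
  ext ξ
  rw [multOp_eq, SchwartzMap.fourierInv_coe, Real.fourierInv_eq_fourier_comp_neg,
    SchwartzMap.fourier_coe]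
  have e : (mulOp w (𝓕⁻ ρ) : R3 → ℂ) = fun x => mulOp w (𝓕 ρ) (-x) := by
    funext x
    rw [mulOp_apply hw, mulOp_apply hw, he, SchwartzMap.fourierInv_coe,
      Real.fourierInv_eq_fourier_neg, SchwartzMap.fourier_coe]
  rw [e]

/-! ### Gaussian superposition for negative powers of the bracket -/

/-- The integrand of the superposition of Gaussians whose Fourier transform is `⟨x⟩^{-a}`. -/
def gaussKernel (a : ℝ) (t : ℝ) (ξ : R3) : ℂ :=
  ((t ^ (a / 2 - 1) * Real.exp (-t) / Real.Gamma (a / 2) : ℝ) : ℂ) *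
    (((Real.pi / t) ^ (3 / 2 : ℝ) * Real.exp (-(Real.pi ^ 2 / t) * ‖ξ‖ ^ 2) : ℝ) : ℂ)

theorem measurable_gaussKernel (a : ℝ) :
    Measurable (Function.uncurry (gaussKernel a)) := by
  unfold gaussKernel Function.uncurry
  fun_prop

theorem measurable_gaussKernel_swap (a : ℝ) :
    Measurable fun p : R3 × ℝ => gaussKernel a p.2 p.1 := by
  unfold gaussKernel
  fun_prop

theorem lintegral_gaussian {b : ℝ} (hb : 0 < b) :
    ∫⁻ ξ : R3, ‖Real.exp (-b * ‖ξ‖ ^ 2)‖ₑ = ENNReal.ofReal ((Real.pi / b) ^ (3 / 2 : ℝ)) := by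
  have h1 := GaussianFourier.integral_rexp_neg_mul_sq_norm (V := R3) hb
  have h2 : Integrable fun ξ : R3 => Real.exp (-b * ‖ξ‖ ^ 2) := by
    by_contra hc
    rw [integral_undef hc] at h1
    have : 0 < (Real.pi / b) ^ (Module.finrank ℝ R3 / 2 : ℝ) := by positivity
    linarith
  have h3 : ∀ ξ : R3, ‖Real.exp (-b * ‖ξ‖ ^ 2)‖ₑ = ENNReal.ofReal (Real.exp (-b * ‖ξ‖ ^ 2)) :=
    fun ξ => Real.enorm_of_nonneg (by positivity)
  simp_rw [h3]
  rw [← ofReal_integral_eq_lintegral_ofReal h2 (.of_forall fun ξ => by positivity), h1]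
  simp

/-- The weight splits through `1 + |ξ|² ≤ (1 + t)(1 + |ξ|²/t)`. Half of the Gaussian exponent
absorbs the second factor and half of `e^{-t}` the first. The `ξ`-integral then cancels
`(π/t)^{3/2}` up to a constant, and a Gamma integral in `t` is left. -/
theorem lintegral_gaussKernel_jap (a : ℝ) (ha : 0 < a) (M : ℝ) (hM : 0 ≤ M) :
    ∫⁻ t in Set.Ioi (0:ℝ), ∫⁻ ξ : R3, ‖gaussKernel a t ξ‖ₑ * ‖jap M ξ‖ₑ < ∞ := by
  obtain ⟨K₁, hK₁, h₁⟩ := exists_one_add_rpow_le_exp (M / 2) (Real.pi ^ 2 / 2) (by positivity)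
  obtain ⟨K₂, hK₂, h₂⟩ := exists_one_add_rpow_le_exp (M / 2) (1 / 2) (by positivity)
  have hΓ : 0 < Real.Gamma (a / 2) := Real.Gamma_pos_of_pos (by positivity)
  set B : ℝ := K₁ * K₂ * 2 ^ (3 / 2 : ℝ) / Real.Gamma (a / 2) with hB
  have main : ∀ t ∈ Set.Ioi (0:ℝ), ∫⁻ ξ : R3, ‖gaussKernel a t ξ‖ₑ * ‖jap M ξ‖ₑ ≤
      ENNReal.ofReal (B * (t ^ (a / 2 - 1) * Real.exp (-(1 / 2) * t ^ (1:ℝ)))) := by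
    intro t ht
    have ht : 0 < t := ht
    set D : ℝ := t ^ (a / 2 - 1) * Real.exp (-t) / Real.Gamma (a / 2) * (Real.pi / t) ^ (3 / 2 : ℝ) *
      (K₁ * (1 + t) ^ (M / 2)) with hD
    have hD0 : 0 ≤ D := by positivity
    have pt : ∀ ξ : R3, ‖gaussKernel a t ξ‖ₑ * ‖jap M ξ‖ₑ ≤
        ENNReal.ofReal D * ‖Real.exp (-(Real.pi ^ 2 / (2 * t)) * ‖ξ‖ ^ 2)‖ₑ := by
      intro ξ
      rw [← enorm_mul, ← ofReal_norm, ← ofReal_norm (Real.exp _), ← ENNReal.ofReal_mul hD0]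
      apply ENNReal.ofReal_le_ofReal
      rw [norm_mul, gaussKernel, norm_mul, Complex.norm_real, Complex.norm_real, norm_jap,
        Real.norm_of_nonneg (by positivity), Real.norm_of_nonneg (by positivity),
        Real.norm_of_nonneg (by positivity)]
      have e1 : (1 + ‖ξ‖ ^ 2) ^ (M / 2) ≤ (1 + t) ^ (M / 2) * (1 + ‖ξ‖ ^ 2 / t) ^ (M / 2) := by
        rw [← Real.mul_rpow (by positivity) (by positivity)]
        refine Real.rpow_le_rpow (by positivity) ?_ (by positivity)
        have : (1 + t) * (1 + ‖ξ‖ ^ 2 / t) = 1 + ‖ξ‖ ^ 2 + (t + ‖ξ‖ ^ 2 / t) := by field_simp; ring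
        rw [this]
        have : 0 ≤ t + ‖ξ‖ ^ 2 / t := by positivity
        linarith
      have e2 := h₁ (‖ξ‖ ^ 2 / t) (by positivity)
      have e3 : Real.exp (-(Real.pi ^ 2 / t) * ‖ξ‖ ^ 2) * Real.exp (Real.pi ^ 2 / 2 * (‖ξ‖ ^ 2 / t)) =
          Real.exp (-(Real.pi ^ 2 / (2 * t)) * ‖ξ‖ ^ 2) := by
        rw [← Real.exp_add]; congr 1; field_simp; ring
      calc _ ≤ t ^ (a / 2 - 1) * Real.exp (-t) / Real.Gamma (a / 2) * ((Real.pi / t) ^ (3 / 2 : ℝ) *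
            Real.exp (-(Real.pi ^ 2 / t) * ‖ξ‖ ^ 2)) * ((1 + t) ^ (M / 2) *
            (K₁ * Real.exp (Real.pi ^ 2 / 2 * (‖ξ‖ ^ 2 / t)))) := by
            gcongr; exact e1.trans (by gcongr)
        _ = D * (Real.exp (-(Real.pi ^ 2 / t) * ‖ξ‖ ^ 2) *
            Real.exp (Real.pi ^ 2 / 2 * (‖ξ‖ ^ 2 / t))) := by rw [hD]; ring
        _ = _ := by rw [e3]
    refine (lintegral_mono pt).trans ?_
    rw [lintegral_const_mul' _ _ ENNReal.ofReal_ne_top, lintegral_gaussian (by positivity),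
      ← ENNReal.ofReal_mul hD0]
    apply ENNReal.ofReal_le_ofReal
    have e4 : (Real.pi / t) ^ (3 / 2 : ℝ) * (Real.pi / (Real.pi ^ 2 / (2 * t))) ^ (3 / 2 : ℝ) =
        2 ^ (3 / 2 : ℝ) := by
      rw [← Real.mul_rpow (by positivity) (by positivity)]
      congr 1; field_simp
    have e5 := h₂ t ht.le
    calc D * (Real.pi / (Real.pi ^ 2 / (2 * t))) ^ (3 / 2 : ℝ)
        = t ^ (a / 2 - 1) * Real.exp (-t) / Real.Gamma (a / 2) *
          (K₁ * (1 + t) ^ (M / 2)) * ((Real.pi / t) ^ (3 / 2 : ℝ) *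
          (Real.pi / (Real.pi ^ 2 / (2 * t))) ^ (3 / 2 : ℝ)) := by rw [hD]; ring
      _ ≤ t ^ (a / 2 - 1) * Real.exp (-t) / Real.Gamma (a / 2) *
          (K₁ * (K₂ * Real.exp (1 / 2 * t))) * 2 ^ (3 / 2 : ℝ) := by
          rw [e4]; gcongr
      _ = B * (t ^ (a / 2 - 1) * (Real.exp (-t) * Real.exp (1 / 2 * t))) := by rw [hB]; ring
      _ = _ := by
        rw [← Real.exp_add, Real.rpow_one]; congr 3; ring
  refine lt_of_le_of_lt (setLIntegral_mono (by fun_prop) main) ?_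
  have hi : IntegrableOn (fun t : ℝ => B * (t ^ (a / 2 - 1) * Real.exp (-(1 / 2) * t ^ (1:ℝ))))
      (Set.Ioi 0) :=
    (integrableOn_rpow_mul_exp_neg_mul_rpow (by linarith) (by norm_num) (by norm_num)).const_mul B
  exact hi.lintegral_lt_top

theorem fourier_gaussKernel (a : ℝ) {t : ℝ} (ht : 0 < t) (x : R3) :
    ∫ ξ, Real.fourierChar (-(inner ℝ ξ x)) • gaussKernel a t ξ =
      ((t ^ (a / 2 - 1) * Real.exp (-t) / Real.Gamma (a / 2) * Real.exp (-t * ‖x‖ ^ 2) : ℝ) : ℂ) := by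
  have h := fourier_gaussian_innerProductSpace (V := R3) (b := ((Real.pi ^ 2 / t : ℝ) : ℂ))
    (by rw [Complex.ofReal_re]; positivity) x
  rw [Real.fourier_eq] at h
  have e : ∀ ξ : R3, Real.fourierChar (-(inner ℝ ξ x)) • gaussKernel a t ξ =
      ((t ^ (a / 2 - 1) * Real.exp (-t) / Real.Gamma (a / 2) * (Real.pi / t) ^ (3 / 2 : ℝ) : ℝ) : ℂ) *
      (Real.fourierChar (-(inner ℝ ξ x)) • Complex.exp (-((Real.pi ^ 2 / t : ℝ) : ℂ) * ‖ξ‖ ^ 2)) := by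
    intro ξ
    simp only [gaussKernel, Circle.smul_def, smul_eq_mul]
    push_cast
    ring
  simp_rw [e]
  rw [integral_const_mul, h]
  have e1 : ((Real.pi : ℂ) / ((Real.pi ^ 2 / t : ℝ) : ℂ)) ^ ((Module.finrank ℝ R3 : ℂ) / 2) =
      (((t / Real.pi) ^ (3 / 2 : ℝ) : ℝ) : ℂ) := by
    rw [Complex.ofReal_cpow (by positivity)]
    congr 1
    · rw [← Complex.ofReal_div]; congr 1; field_simp
    · simp
  have e2 : -(Real.pi : ℂ) ^ 2 * ‖x‖ ^ 2 / ((Real.pi ^ 2 / t : ℝ) : ℂ) = ((-t * ‖x‖ ^ 2 : ℝ) : ℂ) := by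
    rw [← Complex.ofReal_pow, ← Complex.ofReal_pow, ← Complex.ofReal_neg, ← Complex.ofReal_mul,
      ← Complex.ofReal_div]
    congr 1; field_simp
  rw [e1, e2, ← Complex.ofReal_exp, ← Complex.ofReal_mul, ← Complex.ofReal_mul]
  congr 1
  have e3 : (Real.pi / t) ^ (3 / 2 : ℝ) * (t / Real.pi) ^ (3 / 2 : ℝ) = 1 := by
    rw [← Real.mul_rpow (by positivity) (by positivity)]
    have : Real.pi / t * (t / Real.pi) = 1 := by field_simp
    rw [this, Real.one_rpow]
  linear_combination (t ^ (a / 2 - 1) * Real.exp (-t) / Real.Gamma (a / 2) *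
    Real.exp (-t * ‖x‖ ^ 2)) * e3

theorem measurable_uncurry_enorm_gaussKernel_mul (a M : ℝ) :
    Measurable (Function.uncurry fun t ξ => ‖gaussKernel a t ξ‖ₑ * ‖jap M ξ‖ₑ) := by
  have h1 : Measurable (jap M) := (hasTemperateGrowth_jap M).1.continuous.measurable
  exact (measurable_gaussKernel a).enorm.mul (h1.comp measurable_snd).enorm

theorem integrable_fourier_gaussKernel (a : ℝ) (ha : 0 < a) (x : R3) :
    Integrable (fun p : R3 × ℝ =>
      ((Real.fourierChar (-(inner ℝ p.1 x)) : Circle) : ℂ) * gaussKernel a p.2 p.1)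
      ((volume : Measure R3).prod (volume.restrict (Set.Ioi (0:ℝ)))) := by
  have hch : Continuous fun ξ : R3 => Real.fourierChar (-(inner ℝ ξ x)) :=
    Real.continuous_fourierChar.comp (by fun_prop)
  have h1 : Measurable fun ξ : R3 => ((Real.fourierChar (-(inner ℝ ξ x)) : Circle) : ℂ) :=
    (continuous_subtype_val.comp hch).measurable
  have h2 := measurable_gaussKernel_swap a
  have h3 : Measurable fun p : R3 × ℝ =>
    ((Real.fourierChar (-(inner ℝ p.1 x)) : Circle) : ℂ) := h1.comp measurable_fst
  have hmeas : Measurable fun p : R3 × ℝ =>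
    ((Real.fourierChar (-(inner ℝ p.1 x)) : Circle) : ℂ) * gaussKernel a p.2 p.1 := h3.mul h2
  refine ⟨hmeas.aestronglyMeasurable, ?_⟩
  have h0 := lintegral_gaussKernel_jap a ha 0 le_rfl
  rw [lintegral_lintegral_swap (measurable_uncurry_enorm_gaussKernel_mul a 0).aemeasurable] at h0
  rw [HasFiniteIntegral, lintegral_prod _ hmeas.enorm.aemeasurable]
  refine lt_of_le_of_lt (lintegral_mono fun ξ => lintegral_mono fun t => ?_) h0
  have e1 : ‖((Real.fourierChar (-(inner ℝ ξ x)) : Circle) : ℂ)‖ₑ = ‖(1:ℂ)‖ₑ := by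
    rw [← ofReal_norm, ← ofReal_norm, Circle.norm_coe, norm_one]
  rw [enorm_mul, e1, jap_zero, mul_comm]

/-- Uses `Γ(a/2) ⟨x⟩^{-a} = ∫ t^{a/2-1} e^{-t(1+|x|²)} dt` with each Gaussian written as a Fourier
transform. Fubini is justified by the moment bound with `M = 0`. -/
theorem exists_fourier_eq_jap (a : ℝ) (ha : 0 < a) (M : ℝ) (hM : 0 ≤ M) :
    ∃ v : R3 → ℂ, Measurable v ∧ (∫⁻ y, ‖v y‖ₑ * ‖jap M y‖ₑ < ∞) ∧
      ∀ ξ, 𝓕 v ξ = jap (-a) ξ := by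
  refine ⟨fun ξ => ∫ t in Set.Ioi (0:ℝ), gaussKernel a t ξ, ?_, ?_, fun x => ?_⟩
  · exact (StronglyMeasurable.integral_prod_right'
      (f := fun p : R3 × ℝ => gaussKernel a p.2 p.1)
      (measurable_gaussKernel_swap a).stronglyMeasurable).measurable
  · refine lt_of_le_of_lt ?_ (lintegral_gaussKernel_jap a ha M hM)
    rw [lintegral_lintegral_swap (measurable_uncurry_enorm_gaussKernel_mul a M).aemeasurable]
    refine lintegral_mono fun y => ?_
    rw [lintegral_mul_const' _ _ enorm_ne_top]
    gcongr
    exact enorm_integral_le_lintegral_enorm _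
  · rw [Real.fourier_eq]
    have e0 : ∀ ξ : R3, Real.fourierChar (-(inner ℝ ξ x)) •
        (∫ t in Set.Ioi (0:ℝ), gaussKernel a t ξ) =
        ∫ t in Set.Ioi (0:ℝ), ((Real.fourierChar (-(inner ℝ ξ x)) : Circle) : ℂ) *
          gaussKernel a t ξ := by
      intro ξ
      rw [integral_const_mul]; rfl
    simp_rw [e0]
    rw [integral_integral_swap (integrable_fourier_gaussKernel a ha x)]
    have e1 : ∀ t ∈ Set.Ioi (0:ℝ), ∫ ξ, ((Real.fourierChar (-(inner ℝ ξ x)) : Circle) : ℂ) *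
          gaussKernel a t ξ =
        ((t ^ (a / 2 - 1) * Real.exp (-((1 + ‖x‖ ^ 2) * t)) / Real.Gamma (a / 2) : ℝ) : ℂ) := by
      intro t ht
      refine (fourier_gaussKernel a ht x).trans ?_
      have : Real.exp (-((1 + ‖x‖ ^ 2) * t)) = Real.exp (-t) * Real.exp (-t * ‖x‖ ^ 2) := by
        rw [← Real.exp_add]; congr 1; ring
      rw [this]; congr 1; ring
    rw [setIntegral_congr_fun measurableSet_Ioi e1, integral_complex_ofReal, integral_div,
      Real.integral_rpow_mul_exp_neg_mul_Ioi (by positivity) (by positivity), jap]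
    have hΓ : Real.Gamma (a / 2) ≠ 0 := (Real.Gamma_pos_of_pos (by positivity)).ne'
    congr 1
    rw [mul_div_assoc, div_self hΓ, mul_one, one_div, Real.inv_rpow (by positivity),
      ← Real.rpow_neg (by positivity)]
    congr 1; ring

/-- Multiplication by `⟨x⟩^{-a}` is bounded on every Sobolev space. -/
theorem exists_nm_weight_le (a : ℝ) (ha : 0 < a) (s : ℝ) : ∃ A : ℝ, 0 ≤ A ∧ ∀ f : 𝓢(R3, ℂ),
    nm (multOp (jap s) (mulOp (jap (-a)) (multOp (jap (-s)) f))) ≤ A * nm f := by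
  obtain ⟨v, hv, hvi, hvf⟩ := exists_fourier_eq_jap a ha |s| (abs_nonneg s)
  obtain ⟨A, hA, h⟩ := exists_nm_jap_multOp_jap_le hv s hvi (by fun_prop) hvf
  refine ⟨A, hA, fun f => ?_⟩
  -- By Plancherel the roles of position and frequency are exchanged; the weighted convolution bound
  -- then applies to `𝓕 f`.
  rw [nm_multOp, multOp_eq (jap (-s)), fourier_mulOp_fourierInv (by fun_prop)
    (fun x => by simp [jap]), ← nm_fourier f]
  exact h _

section Smoothing

open LineDeriv

/-! ### Weighted smoothing of low frequency cutoffs -/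

theorem hasLineDerivAt_mul {f g : R3 → ℂ} {f' g' : ℂ} {x m : R3}
    (hf : HasLineDerivAt ℝ f f' x m) (hg : HasLineDerivAt ℝ g g' x m) :
    HasLineDerivAt ℝ (fun y => f y * g y) (f' * g x + f x * g') x m := by
  have := HasDerivAt.fun_mul hf hg
  simpa [HasLineDerivAt] using this

theorem hasLineDerivAt_jap (s : ℝ) (x m : R3) :
    HasLineDerivAt ℝ (jap s) (s * ((inner ℝ x m : ℝ) : ℂ) * jap (s - 2) x) x m := by
  have h0 : HasDerivAt (fun t : ℝ => x + t • m) m 0 := by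
    simpa using ((hasDerivAt_id (0:ℝ)).smul_const m).const_add x
  have h1 : HasDerivAt (fun t : ℝ => 1 + ‖x + t • m‖ ^ 2) (2 * inner ℝ x m) 0 := by
    simpa using (h0.norm_sq).const_add 1
  have h2 := (h1.rpow_const (p := s / 2) (Or.inl (by positivity))).ofReal_comp
  have h3 : HasLineDerivAt ℝ (jap s) _ x m := h2
  convert h3 using 1
  rw [jap, show (s - 2) / 2 = s / 2 - 1 by ring]
  simp only [zero_smul, add_zero]
  push_cast
  ring

/-- The algebra of functions generated by `⟨x⟩⁻¹` and the `x_m ⟨x⟩⁻¹`. -/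
inductive BddAlg : (R3 → ℂ) → Prop
  | const (c : ℂ) : BddAlg fun _ => c
  | rho : BddAlg (jap (-1))
  | coord (m : R3) : BddAlg fun x => ((inner ℝ x m : ℝ) : ℂ) * jap (-1) x
  | add {f g : R3 → ℂ} : BddAlg f → BddAlg g → BddAlg fun x => f x + g x
  | mul {f g : R3 → ℂ} : BddAlg f → BddAlg g → BddAlg fun x => f x * g x

theorem BddAlg.hasTemperateGrowth {b : R3 → ℂ} (h : BddAlg b) : b.HasTemperateGrowth := by
  induction h with
  | const c => fun_prop
  | rho => fun_prop
  | coord m => fun_prop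
  | add _ _ h1 h2 => exact h1.add h2
  | mul _ _ h1 h2 => exact h1.mul h2

theorem norm_jap_neg_one_le (x : R3) : ‖jap (-1) x‖ ≤ 1 := by
  rw [norm_jap]
  exact Real.rpow_le_one_of_one_le_of_nonpos (by nlinarith [norm_nonneg x]) (by norm_num)

theorem norm_mul_jap_neg_one_le (x : R3) : ‖x‖ * ‖jap (-1) x‖ ≤ 1 := by
  rw [norm_jap, neg_div, Real.rpow_neg (by positivity), ← div_eq_mul_inv,
    div_le_one (by positivity), ← Real.sqrt_eq_rpow]
  exact Real.le_sqrt_of_sq_le (by linarith)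

theorem BddAlg.bounded {b : R3 → ℂ} (h : BddAlg b) : ∃ A : ℝ, 0 ≤ A ∧ ∀ x, ‖b x‖ ≤ A := by
  induction h with
  | const c => exact ⟨‖c‖, norm_nonneg c, fun _ => le_rfl⟩
  | rho => exact ⟨1, zero_le_one, norm_jap_neg_one_le⟩
  | coord m =>
    refine ⟨‖m‖, norm_nonneg m, fun x => ?_⟩
    rw [norm_mul, Complex.norm_real]
    calc _ ≤ ‖x‖ * ‖m‖ * ‖jap (-1) x‖ := by gcongr; exact norm_inner_le_norm x m
      _ = ‖m‖ * (‖x‖ * ‖jap (-1) x‖) := by ring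
      _ ≤ _ := mul_le_of_le_one_right (norm_nonneg m) (norm_mul_jap_neg_one_le x)
  | add _ _ h1 h2 =>
    obtain ⟨A, hA, h1⟩ := h1
    obtain ⟨B, hB, h2⟩ := h2
    exact ⟨A + B, by positivity, fun x => (norm_add_le _ _).trans (add_le_add (h1 x) (h2 x))⟩
  | mul _ _ h1 h2 =>
    obtain ⟨A, hA, h1⟩ := h1
    obtain ⟨B, hB, h2⟩ := h2
    refine ⟨A * B, by positivity, fun x => ?_⟩
    rw [norm_mul]
    exact mul_le_mul (h1 x) (h2 x) (norm_nonneg _) hA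

theorem jap_add_apply (s t : ℝ) (x : R3) : jap (s + t) x = jap s x * jap t x :=
  (congrFun (jap_mul_jap s t) x).symm

/-- The generators suffice, by the Leibniz rule: `∂_m ⟨x⟩⁻¹ = -(x·m)⟨x⟩⁻³` is again a polynomial in
them. -/
theorem BddAlg.exists_hasLineDerivAt {b : R3 → ℂ} (h : BddAlg b) (m : R3) :
    ∃ b', BddAlg b' ∧ ∀ x, HasLineDerivAt ℝ b (b' x) x m := by
  have hj : ∀ x, HasLineDerivAt ℝ (jap (-1))
      ((-1) * ((((inner ℝ x m : ℝ) : ℂ) * jap (-1) x) * (jap (-1) x * jap (-1) x))) x m := by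
    intro x
    convert hasLineDerivAt_jap (-1) x m using 1
    rw [show (-1 - 2 : ℝ) = -1 + (-1 + -1) by norm_num, jap_add_apply, jap_add_apply]
    push_cast; ring
  induction h with
  | const c =>
    refine ⟨fun _ => 0, .const 0, fun x => ?_⟩
    exact hasDerivAt_const _ _
  | rho => exact ⟨_, .mul (.const _) (.mul (.coord m) (.mul .rho .rho)), hj⟩
  | coord n =>
    refine ⟨_, .add (.mul (.const ((inner ℝ m n : ℝ) : ℂ)) .rho)
      (.mul (.const (-1)) (.mul (.coord n) (.mul (.coord m) .rho))), fun x => ?_⟩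
    have h1 : HasLineDerivAt ℝ (fun x : R3 => ((inner ℝ x n : ℝ) : ℂ)) ((inner ℝ m n : ℝ) : ℂ) x m := by
      have : HasDerivAt (fun t : ℝ => inner ℝ (x + t • m) n) (inner ℝ m n) 0 := by
        simp only [inner_add_left, real_inner_smul_left]
        simpa using ((hasDerivAt_id (0:ℝ)).mul_const (inner ℝ m n)).const_add (inner ℝ x n)
      exact this.ofReal_comp
    convert hasLineDerivAt_mul h1 (hj x) using 1
    ring
  | add _ _ h1 h2 =>
    obtain ⟨f', hf', h1⟩ := h1
    obtain ⟨g', hg', h2⟩ := h2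
    exact ⟨_, .add hf' hg', fun x => HasDerivAt.fun_add (h1 x) (h2 x)⟩
  | @mul f g hf hg h1 h2 =>
    obtain ⟨f', hf', h1⟩ := h1
    obtain ⟨g', hg', h2⟩ := h2
    exact ⟨_, .add (.mul hf' hg) (.mul hf hg'), fun x => hasLineDerivAt_mul (h1 x) (h2 x)⟩

/-- The logarithmic derivative `a (x·m) ⟨x⟩⁻²` of the weight lies in the algebra, so the weight
exponent is unchanged. -/
theorem BddAlg.exists_hasLineDerivAt_jap_mul {b : R3 → ℂ} (h : BddAlg b) (a : ℝ) (m : R3) :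
    ∃ b', BddAlg b' ∧ ∀ x, HasLineDerivAt ℝ (jap a * b) ((jap a * b') x) x m := by
  obtain ⟨b₁, hb₁, h1⟩ := h.exists_hasLineDerivAt m
  refine ⟨_, .add (.mul (.const a) (.mul (.mul (.coord m) .rho) h)) hb₁, fun x => ?_⟩
  convert hasLineDerivAt_mul (hasLineDerivAt_jap a x m) (h1 x) using 1
  · rfl
  · rw [show a - 2 = a + (-1 + -1) by ring, jap_add_apply, jap_add_apply, Pi.mul_apply]
    ring

theorem mulOp_lineDeriv {W W' : R3 → ℂ} (hW : W.HasTemperateGrowth) (hW' : W'.HasTemperateGrowth)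
    {m : R3} (h : ∀ x, HasLineDerivAt ℝ W (W' x) x m) (f : 𝓢(R3, ℂ)) :
    mulOp W (∂_{m} f) = ∂_{m} (mulOp W f) - mulOp W' f := by
  ext x
  have h1 : HasLineDerivAt ℝ f (∂_{m} f x) x m := by
    rw [SchwartzMap.lineDerivOp_apply]
    exact (f.differentiable x).lineDifferentiableAt.hasLineDerivAt
  have h2 := (hasLineDerivAt_mul (h x) h1).lineDeriv
  have h3 : (mulOp W f : R3 → ℂ) = fun y => W y * f y := funext fun y => mulOp_apply hW f y
  rw [sub_apply, SchwartzMap.lineDerivOp_apply, h3, h2, mulOp_apply hW, mulOp_apply hW']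
  ring

/-- The symbol of the directional derivative `∂_m`. -/
def dsym (m : R3) (ξ : R3) : ℂ := 2 * Real.pi * Complex.I * ((inner ℝ ξ m : ℝ) : ℂ)

@[fun_prop]
theorem hasTemperateGrowth_dsym (m : R3) : (dsym m).HasTemperateGrowth := by
  unfold dsym; fun_prop

theorem lineDeriv_eq_multOp (m : R3) (f : 𝓢(R3, ℂ)) : ∂_{m} f = multOp (dsym m) f := by
  have h : dsym m = (2 * Real.pi * Complex.I : ℂ) • fun ξ : R3 => ((inner ℝ ξ m : ℝ) : ℂ) := rfl
  rw [SchwartzMap.lineDeriv_eq_fourierMultiplierCLM, h, multOp,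
    SchwartzMap.fourierMultiplierCLM_smul (by fun_prop)]
  rw [smul_apply]
  congr 1
  exact (SchwartzMap.fourierMultiplierCLM_ofReal ℂ (by fun_prop) f).symm

/-- `T` maps into functions whose weighted low frequency part is controlled in weighted `L²`. -/
def LowControlled (a : ℝ) (T : 𝓢(R3, ℂ) → 𝓢(R3, ℂ)) : Prop :=
  ∀ (Q : 𝓢(R3, ℂ)) (b : R3 → ℂ), BddAlg b → ∃ A : ℝ, 0 ≤ A ∧ ∀ f,
    nm (mulOp (jap a) (multOp Q (mulOp (jap (-a) * b) (T f)))) ≤ A * nm f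

theorem mulOp_add {g h : R3 → ℂ} (hg : g.HasTemperateGrowth) (hh : h.HasTemperateGrowth)
    (f : 𝓢(R3, ℂ)) : mulOp (g + h) f = mulOp g f + mulOp h f := by
  ext x
  rw [add_apply, mulOp_apply (hg.add hh), mulOp_apply hg, mulOp_apply hh,
    Pi.add_apply, add_mul]

theorem multOp_add {g h : R3 → ℂ} (hg : g.HasTemperateGrowth) (hh : h.HasTemperateGrowth)
    (f : 𝓢(R3, ℂ)) : multOp (g + h) f = multOp g f + multOp h f := by
  simp only [multOp_eq, mulOp_add hg hh, FourierTransform.fourierInv_add]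

theorem multOp_smul {g : R3 → ℂ} (hg : g.HasTemperateGrowth) (c : ℂ)
    (f : 𝓢(R3, ℂ)) : multOp (c • g) f = c • multOp g f := by
  rw [multOp, SchwartzMap.fourierMultiplierCLM_smul hg, smul_apply]

theorem multOp_jap_two (f : 𝓢(R3, ℂ)) : multOp (jap 2) f = f + (-(1 / (4 * Real.pi ^ 2) : ℂ)) •
    ∑ i, ∂_{EuclideanSpace.basisFun (Fin 3) ℝ i} (∂_{EuclideanSpace.basisFun (Fin 3) ℝ i} f) := by
  rw [← SchwartzMap.laplacian_eq_sum, SchwartzMap.laplacian_eq_fourierMultiplierCLM,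
    ← SchwartzMap.fourierMultiplierCLM_ofReal ℂ (by fun_prop)]
  have h : jap 2 = jap 0 + fun x : R3 => ((‖x‖ ^ 2 : ℝ) : ℂ) := by
    ext x; simp [jap]
  rw [h, multOp_add (by fun_prop) (by fun_prop), multOp_jap_zero]
  congr 1
  have h4 : (-(2 * Real.pi) ^ 2 : ℝ) • multOp (fun x : R3 => ((‖x‖ ^ 2 : ℝ) : ℂ)) f =
    ((-(2 * Real.pi) ^ 2 : ℝ) : ℂ) • multOp (fun x : R3 => ((‖x‖ ^ 2 : ℝ) : ℂ)) f := by
    ext x; simp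
  have h5 : (-(1 / (4 * Real.pi ^ 2) : ℂ)) * ((-(2 * Real.pi) ^ 2 : ℝ) : ℂ) = 1 := by
    have : (Real.pi : ℂ) ≠ 0 := by exact_mod_cast Real.pi_ne_zero
    push_cast; field_simp; ring
  refine Eq.trans ?_ (congrArg (fun u => (-(1 / (4 * Real.pi ^ 2) : ℂ)) • u) h4).symm
  simp only [smul_smul]
  rw [h5, one_smul]

theorem lintegral_schwartz_mul_jap (h : 𝓢(R3, ℂ)) (s : ℝ) : ∫⁻ y, ‖h y‖ₑ * ‖jap s y‖ₑ < ∞ := by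
  have h1 := ((mulOp (jap s) h).integrable (μ := (volume : Measure R3))).2
  refine lt_of_le_of_lt (le_of_eq (lintegral_congr fun y => ?_)) h1
  rw [mulOp_apply (by fun_prop), enorm_mul, mul_comm]

/-- A Schwartz symbol has a Schwartz convolution kernel, which Peetre's inequality makes bounded on
weighted `L²`; the bounded factor `b` is then discarded. -/
theorem LowControlled.id (a : ℝ) : LowControlled a fun f => f := by
  intro Q b hb
  obtain ⟨B, hB, hb'⟩ := hb.bounded
  obtain ⟨A, hA, h⟩ := exists_nm_jap_multOp_jap_le (𝓕⁻ Q).continuous.measurable a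
    (lintegral_schwartz_mul_jap (𝓕⁻ Q) |a|) (Q := Q) (SchwartzMap.hasTemperateGrowth Q)
    (fun ξ => by rw [← SchwartzMap.fourier_coe]; simp)
  refine ⟨A * B, by positivity, fun f => ?_⟩
  rw [← mulOp_mulOp (by fun_prop) hb.hasTemperateGrowth, mul_assoc]
  refine (h _).trans ?_
  gcongr
  exact nm_mulOp_le hb.hasTemperateGrowth hB hb' f

theorem LowControlled.add {a : ℝ} {T U : 𝓢(R3, ℂ) → 𝓢(R3, ℂ)} (hT : LowControlled a T)
    (hU : LowControlled a U) : LowControlled a fun f => T f + U f := by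
  intro Q b hb
  obtain ⟨A, hA, h1⟩ := hT Q b hb
  obtain ⟨B, hB, h2⟩ := hU Q b hb
  refine ⟨A + B, by positivity, fun f => ?_⟩
  simp only [map_add, add_mul]
  exact (nm_add_le _ _).trans (add_le_add (h1 f) (h2 f))

theorem LowControlled.smul {a : ℝ} {T : 𝓢(R3, ℂ) → 𝓢(R3, ℂ)} (hT : LowControlled a T)
    (c : ℂ) : LowControlled a fun f => c • T f := by
  intro Q b hb
  obtain ⟨A, hA, h1⟩ := hT Q b hb
  refine ⟨‖c‖ * A, by positivity, fun f => ?_⟩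
  simp only [map_smul, nm_smul, mul_assoc]
  gcongr
  exact h1 f

/-- Commuting `∂_m` to the left past `⟨x⟩^{-a} b` lets `Q` absorb it, since `dsym m * Q` is again
Schwartz. The commutator is `⟨x⟩^{-a} b'` with `b'` in the algebra. This is why `LowControlled`
quantifies over all `Q` and `b`. -/
theorem LowControlled.lineDeriv {a : ℝ} {T : 𝓢(R3, ℂ) → 𝓢(R3, ℂ)} (hT : LowControlled a T)
    (m : R3) : LowControlled a fun f => ∂_{m} (T f) := by
  intro Q b hb
  obtain ⟨b', hb', hd⟩ := hb.exists_hasLineDerivAt_jap_mul (-a) m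
  obtain ⟨A, hA, h1⟩ := hT (mulOp (dsym m) Q) b hb
  obtain ⟨B, hB, h2⟩ := hT Q b' hb'
  refine ⟨A + B, by positivity, fun f => ?_⟩
  have e : (mulOp (dsym m) Q : R3 → ℂ) = (Q : R3 → ℂ) * dsym m := by
    ext x; rw [mulOp_apply (by fun_prop), Pi.mul_apply, mul_comm]
  rw [mulOp_lineDeriv ((hasTemperateGrowth_jap _).mul hb.hasTemperateGrowth)
    ((hasTemperateGrowth_jap _).mul hb'.hasTemperateGrowth) hd, map_sub, map_sub, add_mul,
    lineDeriv_eq_multOp, multOp_multOp Q.hasTemperateGrowth (by fun_prop), ← e]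
  exact (nm_sub_le _ _).trans (add_le_add (h1 f) (h2 f))

theorem LowControlled.jap_two {a : ℝ} {T : 𝓢(R3, ℂ) → 𝓢(R3, ℂ)} (hT : LowControlled a T) :
    LowControlled a fun f => multOp (jap 2) (T f) := by
  simp only [multOp_jap_two, Fin.sum_univ_three]
  exact hT.add (((((hT.lineDeriv _).lineDeriv _).add ((hT.lineDeriv _).lineDeriv _)).add
    ((hT.lineDeriv _).lineDeriv _)).smul _)

theorem LowControlled.jap_two_mul (a : ℝ) (n : ℕ) :
    LowControlled a fun f => multOp (jap (2 * n)) f := by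
  induction n with
  | zero => simpa [multOp_jap_zero] using LowControlled.id a
  | succ n ih =>
    convert ih.jap_two using 2 with f
    rw [multOp_jap_jap]; push_cast; rw [mul_add, mul_one, add_comm]

/-- A low frequency cutoff maps the weighted Sobolev spaces of arbitrary order to weighted `L²`. -/
theorem exists_nm_low_le (Q : 𝓢(R3, ℂ)) (a s : ℝ) : ∃ A : ℝ, 0 ≤ A ∧ ∀ f : 𝓢(R3, ℂ),
    nm (mulOp (jap a) (multOp Q (mulOp (jap (-a)) (multOp (jap s) f)))) ≤ A * nm f := by
  -- Even powers of `⟨D⟩` are differential operators; the remaining `⟨D⟩^{s-2n}` has nonpositive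
  -- order and is a contraction on `L²`.
  obtain ⟨n, hn⟩ := exists_nat_ge (s / 2)
  obtain ⟨A, hA, h⟩ := LowControlled.jap_two_mul a n Q _ (.const 1)
  refine ⟨A, hA, fun f => ?_⟩
  have e : jap (-a) * (fun _ => 1) = jap (-a) := by ext x; simp
  have h1 := h (multOp (jap (s - 2 * n)) f)
  beta_reduce at h1
  rw [e, multOp_jap_jap, show 2 * (n:ℝ) + (s - 2 * n) = s by ring] at h1
  refine h1.trans ?_
  gcongr
  refine (nm_multOp_jap_le (t := 0) (by linarith) f).trans (le_of_eq ?_)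
  rw [multOp_jap_zero]

/-- Dual form of `exists_nm_low_le`. -/
theorem exists_nm_low_le' (Q : 𝓢(R3, ℂ)) (hQ : ∀ x, (starRingEnd ℂ) (Q x) = Q x) (a s : ℝ) :
    ∃ A : ℝ, 0 ≤ A ∧ ∀ f : 𝓢(R3, ℂ),
    nm (multOp (jap s) (mulOp (jap (-a)) (multOp Q (mulOp (jap a) f)))) ≤ A * nm f := by
  obtain ⟨A, hA, h⟩ := exists_nm_low_le Q a s
  refine ⟨A, hA, nm_le_of_adjoint (fun f g => ?_) h⟩
  rw [ip_multOp (by fun_prop) (conj_jap s), ip_mulOp (by fun_prop) (conj_jap _),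
    ip_multOp Q.hasTemperateGrowth hQ, ip_mulOp (by fun_prop) (conj_jap _)]

end Smoothing

/-! ### The outgoing kernels and their Fourier transforms -/

/-- The kernels `r^{j-1} e^{izr}`, `r = |x|`. -/
def kern (j : ℕ) (z : ℂ) (x : R3) : ℂ :=
  (‖x‖ : ℂ) ^ j * Complex.exp (Complex.I * z * ‖x‖) / ‖x‖

theorem measurable_kern (j : ℕ) (z : ℂ) : Measurable (kern j z) := by
  unfold kern; fun_prop

theorem norm_exp_I_mul (z : ℂ) (r : ℝ) :
    ‖Complex.exp (Complex.I * z * r)‖ = Real.exp (-(z.im * r)) := by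
  rw [Complex.norm_exp]; simp

theorem norm_kern (j : ℕ) (z : ℂ) (x : R3) :
    ‖kern j z x‖ = ‖x‖ ^ j * Real.exp (-(z.im * ‖x‖)) / ‖x‖ := by
  rw [kern, norm_div, norm_mul, norm_exp_I_mul]; simp

/-- In polar coordinates the modulus becomes `r^{j+1} e^{-r Im z}`: the Jacobian `r²` removes the
singularity. -/
theorem integrable_kern (j : ℕ) {z : ℂ} (hz : 0 < z.im) : Integrable (kern j z) := by
  have h1 : Integrable (fun x : R3 => (fun r : ℝ => r ^ j * Real.exp (-(z.im * r)) / r) ‖x‖) := by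
    refine (integrable_fun_norm_addHaar (volume : Measure R3)
      (f := fun r : ℝ => r ^ j * Real.exp (-(z.im * r)) / r)).2 ?_
    have h2 := integrableOn_rpow_mul_exp_neg_mul_rpow (p := 1) (s := j + 1) (b := z.im)
      (by linarith [(Nat.cast_nonneg j : (0:ℝ) ≤ j)]) one_pos hz
    refine h2.congr_fun (fun r hr => ?_) measurableSet_Ioi
    have hr : (0:ℝ) < r := hr
    simp only [finrank_euclideanSpace, Fintype.card_fin, smul_eq_mul, Real.rpow_one]
    rw [Real.rpow_add hr, Real.rpow_natCast, Real.rpow_one]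
    field_simp
  refine h1.mono (measurable_kern j z).aestronglyMeasurable (.of_forall fun x => ?_)
  rw [norm_kern, Real.norm_of_nonneg (by positivity)]

/-! ### Fourier transform of `e^{izr}/r` by slicing -/

/-- The plane orthogonal to the first coordinate axis. -/
abbrev R2 : Type := EuclideanSpace ℝ (Fin 2)

/-- Splitting off the first coordinate. -/
def splitEquiv : R3 ≃ᵐ ℝ × R2 :=
  (MeasurableEquiv.toLp 2 (Fin 3 → ℝ)).symm.trans
    ((MeasurableEquiv.piFinSuccAbove (fun _ : Fin 3 => ℝ) 0).trans
      (MeasurableEquiv.prodCongr (MeasurableEquiv.refl ℝ) (MeasurableEquiv.toLp 2 (Fin 2 → ℝ))))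

theorem measurePreserving_splitEquiv : MeasurePreserving splitEquiv volume volume := by
  have h1 := EuclideanSpace.volume_preserving_symm_measurableEquiv_toLp (Fin 3)
  have h2 := volume_preserving_piFinSuccAbove (fun _ : Fin 3 => ℝ) 0
  have h3 := (MeasurePreserving.id (volume : Measure ℝ)).prod
    (PiLp.volume_preserving_toLp (Fin 2))
  exact h3.comp (h2.comp h1)

theorem splitEquiv_fst (x : R3) : (splitEquiv x).1 = x 0 := rfl

theorem norm_eq_splitEquiv (x : R3) :
    ‖x‖ = √((splitEquiv x).1 ^ 2 + ‖(splitEquiv x).2‖ ^ 2) := by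
  have h2 : ∀ i, (splitEquiv x).2 i = x i.succ := fun i => rfl
  rw [EuclideanSpace.norm_eq, EuclideanSpace.norm_sq_eq, splitEquiv_fst]
  simp only [h2, Real.norm_eq_abs, sq_abs]
  rw [Fin.sum_univ_succ]

theorem tendsto_exp_I_mul_atTop {z : ℂ} (hz : 0 < z.im) {u : ℝ → ℝ}
    (hu : Filter.Tendsto u Filter.atTop Filter.atTop) :
    Filter.Tendsto (fun y => Complex.exp (Complex.I * z * u y)) Filter.atTop (nhds 0) := by
  rw [tendsto_zero_iff_norm_tendsto_zero]
  simp_rw [norm_exp_I_mul]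
  exact Real.tendsto_exp_neg_atTop_nhds_zero.comp (hu.const_mul_atTop hz)

/-- With `ρ = √(t² + y²)` one has `y dy = ρ dρ`, so the radial integrand is the exact derivative of
`e^{izρ}/(iz)`. Only the endpoint `ρ = |t|` contributes, because `Im z > 0`. -/
theorem integral_slice {z : ℂ} (hz : 0 < z.im) (t : ℝ) :
    ∫ y : R2, Complex.exp (Complex.I * z * √(t ^ 2 + ‖y‖ ^ 2)) / √(t ^ 2 + ‖y‖ ^ 2) =
      2 * Real.pi * Complex.I / z * Complex.exp (Complex.I * z * |t|) := by
  have hz0 : z ≠ 0 := fun h => by simp [h] at hz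
  rw [integral_fun_norm_addHaar volume
    (fun r : ℝ => Complex.exp (Complex.I * z * √(t ^ 2 + r ^ 2)) / √(t ^ 2 + r ^ 2))]
  have hle : ∀ y : ℝ, 0 < y → y ≤ √(t ^ 2 + y ^ 2) := fun y hy =>
    Real.le_sqrt_of_sq_le (by nlinarith [sq_nonneg t])
  have key : ∫ y in Set.Ioi (0:ℝ), ((y:ℂ) * (Complex.exp (Complex.I * z * √(t ^ 2 + y ^ 2)) /
      √(t ^ 2 + y ^ 2))) = 0 - Complex.exp (Complex.I * z * √(t ^ 2 + 0 ^ 2)) / (Complex.I * z) := by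
    refine integral_Ioi_of_hasDerivAt_of_tendsto
      (f := fun y : ℝ => Complex.exp (Complex.I * z * √(t ^ 2 + y ^ 2)) / (Complex.I * z))
      ?_ (fun y hy => ?_) ?_ ?_
    · exact Continuous.continuousWithinAt (by fun_prop)
    · have hy : (0:ℝ) < y := hy
      have hp : 0 < t ^ 2 + y ^ 2 := by positivity
      have hs : √(t ^ 2 + y ^ 2) ≠ 0 := (Real.sqrt_pos.2 hp).ne'
      have h1 : HasDerivAt (fun y : ℝ => √(t ^ 2 + y ^ 2)) (2 * y / (2 * √(t ^ 2 + y ^ 2))) y := by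
        simpa using (((hasDerivAt_pow 2 y).const_add (t ^ 2)).sqrt hp.ne')
      have h2 := ((h1.ofReal_comp.const_mul (Complex.I * z)).cexp).div_const (Complex.I * z)
      have hs' : ((√(t ^ 2 + y ^ 2) : ℝ) : ℂ) ≠ 0 := by exact_mod_cast hs
      refine h2.congr_deriv ?_
      have hI := Complex.I_ne_zero
      push_cast
      field_simp
    · have h2 := integrableOn_rpow_mul_exp_neg_mul_rpow (p := 1) (s := 0) (b := z.im)
        (by norm_num) one_pos hz
      refine h2.mono' (Measurable.aestronglyMeasurable (by fun_prop)) ?_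
      filter_upwards [ae_restrict_mem measurableSet_Ioi] with y hy
      have hy : (0:ℝ) < y := hy
      rw [norm_mul, norm_div, norm_exp_I_mul, Complex.norm_real, Complex.norm_real,
        Real.norm_of_nonneg hy.le, Real.norm_of_nonneg (Real.sqrt_nonneg _), Real.rpow_zero,
        Real.rpow_one, one_mul]
      have hs : 0 < √(t ^ 2 + y ^ 2) := hy.trans_le (hle y hy)
      calc y * (Real.exp (-(z.im * √(t ^ 2 + y ^ 2))) / √(t ^ 2 + y ^ 2)) =
          (y / √(t ^ 2 + y ^ 2)) * Real.exp (-(z.im * √(t ^ 2 + y ^ 2))) := by ring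
        _ ≤ 1 * Real.exp (-z.im * y) := by
          gcongr
          · rw [div_le_one hs]; exact hle y hy
          · nlinarith [hle y hy]
        _ = _ := one_mul _
    · have h := (tendsto_exp_I_mul_atTop hz (u := fun y => √(t ^ 2 + y ^ 2)) ?_).div_const
        (Complex.I * z)
      · simpa using h
      · refine Filter.tendsto_atTop_mono' _ ?_ Filter.tendsto_id
        filter_upwards [Filter.eventually_gt_atTop 0] with y hy using hle y hy
  simp only [finrank_euclideanSpace, Fintype.card_fin, Nat.add_one_sub_one, pow_one]
  have e : ∀ y : ℝ, y • (Complex.exp (Complex.I * z * √(t ^ 2 + y ^ 2)) / √(t ^ 2 + y ^ 2)) =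
      (y:ℂ) * (Complex.exp (Complex.I * z * √(t ^ 2 + y ^ 2)) / √(t ^ 2 + y ^ 2)) :=
    fun y => Complex.real_smul
  simp_rw [e]
  rw [key, Measure.real, EuclideanSpace.volume_ball_fin_two]
  have hI := Complex.I_ne_zero
  simp only [ENNReal.ofReal_one, one_pow, one_mul, ENNReal.toReal_ofReal Real.pi_pos.le,
    Complex.real_smul, nsmul_eq_mul, Nat.cast_ofNat, ne_eq, OfNat.ofNat_ne_zero, not_false_eq_true,
    zero_pow, add_zero, Real.sqrt_sq_eq_abs, zero_sub]
  field_simp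
  rw [Complex.I_sq]

theorem integral_exp_abs {z : ℂ} (hz : 0 < z.im) (l : ℝ) :
    ∫ t : ℝ, Complex.exp (-(Complex.I * l * t)) * Complex.exp (Complex.I * z * |t|) =
      2 * Complex.I * z / (z ^ 2 - l ^ 2) := by
  have r1 : (Complex.I * z - Complex.I * l).re < 0 := by simpa using hz
  have r2 : (Complex.I * z + Complex.I * l).re < 0 := by simpa using hz
  have e1 : ∀ t ∈ Set.Ioi (0:ℝ), Complex.exp (-(Complex.I * l * t)) *
      Complex.exp (Complex.I * z * |t|) = Complex.exp ((Complex.I * z - Complex.I * l) * t) := by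
    intro t ht
    rw [abs_of_pos ht, ← Complex.exp_add]; congr 1; ring
  have e2 : ∀ t ∈ Set.Iic (0:ℝ), Complex.exp (-(Complex.I * l * t)) *
      Complex.exp (Complex.I * z * |t|) =
      (fun t : ℝ => Complex.exp ((Complex.I * z + Complex.I * l) * t)) (-t) := by
    intro t ht
    rw [abs_of_nonpos ht, ← Complex.exp_add]; congr 1; push_cast; ring
  have i1 := integrableOn_exp_mul_complex_Ioi r1 0
  have i2 := integrableOn_exp_mul_complex_Ioi r2 0
  have i2' : IntegrableOn (fun t : ℝ =>
      (fun t : ℝ => Complex.exp ((Complex.I * z + Complex.I * l) * t)) (-t)) (Set.Iic 0) := by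
    have := (Measure.measurePreserving_neg (volume : Measure ℝ)).integrableOn_comp_preimage
      (Homeomorph.neg ℝ).measurableEmbedding (f := fun t : ℝ =>
        Complex.exp ((Complex.I * z + Complex.I * l) * t)) (s := Set.Ici 0)
    rw [show (Neg.neg ⁻¹' Set.Ici (0:ℝ)) = Set.Iic 0 by ext; simp] at this
    exact this.2 ((integrableOn_Ici_iff_integrableOn_Ioi (by simp)).2 i2)
  rw [← intervalIntegral.integral_Iic_add_Ioi (b := 0)
    (i2'.congr_fun (fun t ht => (e2 t ht).symm) measurableSet_Iic)
    (i1.congr_fun (fun t ht => (e1 t ht).symm) measurableSet_Ioi),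
    setIntegral_congr_fun measurableSet_Iic e2, setIntegral_congr_fun measurableSet_Ioi e1,
    integral_comp_neg_Iic 0 (fun t : ℝ => Complex.exp ((Complex.I * z + Complex.I * l) * t)),
    neg_zero, integral_exp_mul_complex_Ioi r1, integral_exp_mul_complex_Ioi r2]
  have n1 : z - l ≠ 0 := fun h => by
    have := congrArg Complex.im h; simp at this; linarith
  have n2 : z + l ≠ 0 := fun h => by
    have := congrArg Complex.im h; simp at this; linarith
  have n3 : z ^ 2 - (l:ℂ) ^ 2 ≠ 0 := by
    rw [show z ^ 2 - (l:ℂ) ^ 2 = (z - l) * (z + l) by ring]; exact mul_ne_zero n1 n2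
  rw [← mul_sub, ← mul_add]
  simp only [Complex.ofReal_zero, mul_zero, Complex.exp_zero]
  rw [show z ^ 2 - (l:ℂ) ^ 2 = (z - l) * (z + l) by ring]
  have hI := Complex.I_ne_zero
  field_simp
  rw [Complex.I_sq]; ring

theorem exists_isometry_apply_eq (ξ : R3) : ∃ A : R3 ≃ₗᵢ[ℝ] R3,
    A (‖ξ‖ • EuclideanSpace.basisFun (Fin 3) ℝ 0) = ξ := by
  rcases eq_or_ne ξ 0 with rfl | hξ
  · exact ⟨LinearIsometryEquiv.refl ℝ R3, by simp⟩
  · obtain ⟨b, hb⟩ := Orthonormal.exists_orthonormalBasis_extension_of_card_eq (𝕜 := ℝ) (E := R3)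
      (ι := Fin 3) (by simp) (v := fun _ => (‖ξ‖⁻¹ : ℝ) • ξ) (s := {0}) (by
        rw [orthonormal_iff_ite]
        intro i j
        have : i = j := Subsingleton.elim _ _
        have hn : ‖ξ‖ ≠ 0 := norm_ne_zero_iff.2 hξ
        simp [this, Set.domRestrict, norm_smul, hn])
    refine ⟨b.repr.symm, ?_⟩
    rw [map_smul, EuclideanSpace.basisFun_apply, OrthonormalBasis.repr_symm_single,
      hb 0 rfl, smul_smul, mul_inv_cancel₀ (norm_ne_zero_iff.2 hξ), one_smul]

/-- The kernel is radial, so `ξ` may be rotated to the first axis, where the phase depends on one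
coordinate only. Integrating over the orthogonal plane leaves the one-dimensional transform of
`e^{iz|t|}` at frequency `2π|ξ|`. -/
theorem fourier_kern_zero {z : ℂ} (hz : 0 < z.im) (ξ : R3) :
    𝓕 (kern 0 z) ξ = 4 * Real.pi / (4 * Real.pi ^ 2 * ‖ξ‖ ^ 2 - z ^ 2) := by
  obtain ⟨A, hA⟩ := exists_isometry_apply_eq ξ
  have hrad : kern 0 z ∘ A = kern 0 z := by
    ext x; simp [kern]
  have h1 := Real.fourier_comp_linearIsometry A (kern 0 z)
    (‖ξ‖ • EuclideanSpace.basisFun (Fin 3) ℝ 0)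
  rw [hA, hrad] at h1
  rw [← h1, Real.fourier_eq]
  set l : ℝ := 2 * Real.pi * ‖ξ‖ with hl
  set G : ℝ × R2 → ℂ := fun p => Complex.exp (-(Complex.I * l * p.1)) *
    (Complex.exp (Complex.I * z * √(p.1 ^ 2 + ‖p.2‖ ^ 2)) / √(p.1 ^ 2 + ‖p.2‖ ^ 2)) with hG
  have e : ∀ x : R3, Real.fourierChar (-(inner ℝ x (‖ξ‖ • EuclideanSpace.basisFun (Fin 3) ℝ 0))) •
      kern 0 z x = G (splitEquiv x) := by
    intro x
    simp only [hG]
    rw [← norm_eq_splitEquiv, splitEquiv_fst, Circle.smul_def, Real.fourierChar_apply, kern,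
      smul_eq_mul, pow_zero, one_mul, inner_smul_right, real_inner_comm,
      EuclideanSpace.basisFun_inner]
    congr 2
    rw [hl]; push_cast; ring
  simp_rw [e]
  have hGi : Integrable G := by
    rw [← measurePreserving_splitEquiv.integrable_comp_emb splitEquiv.measurableEmbedding]
    have := (Real.fourierIntegral_convergent_iff (‖ξ‖ • EuclideanSpace.basisFun (Fin 3) ℝ 0)).2
      (integrable_kern 0 hz)
    exact this.congr (.of_forall e)
  rw [measurePreserving_splitEquiv.integral_comp splitEquiv.measurableEmbedding G,
    Measure.volume_eq_prod, integral_prod _ hGi]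
  simp only [hG]
  simp_rw [integral_const_mul, integral_slice hz]
  have e2 : ∀ t : ℝ, Complex.exp (-(Complex.I * l * t)) *
      (2 * Real.pi * Complex.I / z * Complex.exp (Complex.I * z * |t|)) =
      2 * Real.pi * Complex.I / z * (Complex.exp (-(Complex.I * l * t)) *
        Complex.exp (Complex.I * z * |t|)) := fun t => by ring
  simp_rw [e2]
  rw [integral_const_mul, integral_exp_abs hz]
  have hz0 : z ≠ 0 := fun h => by simp [h] at hz
  have e3 : (4 * Real.pi ^ 2 * ‖ξ‖ ^ 2 - z ^ 2 : ℂ) = -(z ^ 2 - (l:ℂ) ^ 2) := by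
    rw [hl]; push_cast; ring
  rw [e3, div_neg, ← neg_div, div_mul_div_comm, mul_comm z, ← mul_assoc, mul_div_mul_right]
  · congr 1
    linear_combination (4 * Real.pi : ℂ) * Complex.I_sq
  · exact hz0

/-! ### The symbols of powers of the resolvent -/

/-- The symbol of `-Δ`. -/
def lamSq (ξ : R3) : ℂ := 4 * Real.pi ^ 2 * ‖ξ‖ ^ 2

theorem lamSq_eq (ξ : R3) : lamSq ξ = ((4 * Real.pi ^ 2 * ‖ξ‖ ^ 2 : ℝ) : ℂ) := by
  rw [lamSq]; push_cast; rfl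

@[fun_prop]
theorem hasTemperateGrowth_lamSq : lamSq.HasTemperateGrowth := by
  have : lamSq = fun ξ : R3 => ((4 * Real.pi ^ 2 * ‖ξ‖ ^ 2 : ℝ) : ℂ) := funext lamSq_eq
  rw [this]; fun_prop

theorem ofReal_sub_sq_ne_zero {z : ℂ} (hz : z.im ≠ 0) {A : ℝ} (hA : 0 ≤ A) :
    (A : ℂ) - z ^ 2 ≠ 0 := by
  intro h
  have h1 := congrArg Complex.re h
  have h2 := congrArg Complex.im h
  simp [pow_two] at h1 h2
  have h3 : z.re = 0 := by
    have : z.re * z.im = 0 := by linarith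
    exact (mul_eq_zero.1 this).resolve_right hz
  rw [h3] at h1
  nlinarith [mul_self_pos.2 hz]

theorem lamSq_sub_ne_zero {z : ℂ} (hz : z.im ≠ 0) (ξ : R3) : lamSq ξ - z ^ 2 ≠ 0 := by
  rw [lamSq_eq]; exact ofReal_sub_sq_ne_zero hz (by positivity)

/-- `powSym m A z = ((λ - z)^{-m} - (-λ - z)^{-m}) / (2λ)` with `λ² = A`. -/
def powSym : ℕ → ℂ → ℂ → ℂ
  | 0, _, _ => 0
  | 1, A, z => 1 / (A - z ^ 2)
  -- The numbers `(±λ - z)⁻¹` are the roots of `X² = (2zX + 1)/(A - z²)`, which gives a recursion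
  -- free of the square root `λ`.
  | m + 2, A, z => (2 * z * powSym (m + 1) A z + powSym m A z) / (A - z ^ 2)

/-- Transfers the estimates from the upper half-plane, where `e^{izr}` decays, to the lower one. -/
theorem powSym_neg (m : ℕ) (A z : ℂ) : powSym m A (-z) = (-1) ^ (m + 1) * powSym m A z := by
  induction m using Nat.twoStepInduction with
  | zero => simp [powSym]
  | one => simp [powSym]
  | more m h1 h2 =>
    rw [powSym, powSym, h1, h2, neg_sq]
    ring

/-- Reflects `d/dz (μ - z)^{-m} = m (μ - z)^{-m-1}` at `μ = ±λ`, proved through the recursion. -/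
theorem hasDerivAt_powSym (m : ℕ) {A z : ℂ} (h : A - z ^ 2 ≠ 0) :
    HasDerivAt (powSym m A) (m * powSym (m + 1) A z) z := by
  have hD : HasDerivAt (fun z : ℂ => A - z ^ 2) (-(2 * z)) z := by
    simpa using (hasDerivAt_pow 2 z).const_sub A
  induction m using Nat.twoStepInduction with
  | zero =>
    simp only [Nat.cast_zero, zero_mul]
    exact (hasDerivAt_const z (0:ℂ)).congr_of_eventuallyEq (.of_forall fun w => by simp [powSym])
  | one =>
    have h1 := (hasDerivAt_const z (1:ℂ)).fun_div hD h
    have h2 : powSym 1 A = fun z => 1 / (A - z ^ 2) := by ext w; rw [powSym]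
    rw [h2]
    refine h1.congr_deriv ?_
    simp only [powSym]
    field_simp
    push_cast; ring
  | more m h1 h2 =>
    have h3 := (((hasDerivAt_id z).const_mul 2).fun_mul h2 |>.fun_add h1).fun_div hD h
    have h4 : powSym (m + 2) A =
        fun z => (2 * id z * powSym (m + 1) A z + powSym m A z) / (A - z ^ 2) := by
      ext w; rw [powSym]; rfl
    rw [h4]
    refine h3.congr_deriv ?_
    have e3 : powSym (m + 2 + 1) A z =
      (2 * z * powSym (m + 2) A z + powSym (m + 1) A z) / (A - z ^ 2) := by rw [powSym]
    have e2 : powSym (m + 1 + 1) A z = powSym (m + 2) A z := rfl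
    have e4 : 2 * z * powSym (m + 1) A z + powSym m A z = powSym (m + 2) A z * (A - z ^ 2) := by
      rw [powSym]; field_simp
    simp only [id]
    rw [e3, e2, e4]
    push_cast
    field_simp
    ring

/-- The resolvent symbol has temperate growth. -/
theorem hasTemperateGrowth_resolvent {z : ℂ} (hz : z.im ≠ 0) :
    (fun ξ => 1 / (lamSq ξ - z ^ 2)).HasTemperateGrowth := by
  -- If `z` is imaginary, the symbol is a rescaled `⟨ξ⟩⁻²`. Otherwise `β = Im z² ≠ 0`, and
  -- multiplying by the conjugate gives the denominator `β²(1 + ((λ² - α)/β)²)`.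
  rcases eq_or_ne z.re 0 with h0 | h0
  · have e : (fun ξ => 1 / (lamSq ξ - z ^ 2)) = fun ξ : R3 => ((1 / z.im ^ 2 : ℝ) : ℂ) *
        (((1 + ‖(2 * Real.pi / z.im) • ξ‖ ^ 2) ^ (-1 : ℝ) : ℝ) : ℂ) := by
      ext ξ
      have hz2 : z ^ 2 = ((-z.im ^ 2 : ℝ) : ℂ) := by
        apply Complex.ext <;> simp [pow_two, h0]
      rw [lamSq_eq, hz2, ← Complex.ofReal_sub, ← Complex.ofReal_mul, ← Complex.ofReal_one,
        ← Complex.ofReal_div, Real.rpow_neg_one, norm_smul, mul_pow, Real.norm_eq_abs, sq_abs]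
      congr 1
      have : 4 * Real.pi ^ 2 * ‖ξ‖ ^ 2 - -z.im ^ 2 ≠ 0 := by
        have : 0 < z.im ^ 2 := by positivity
        have : 0 ≤ 4 * Real.pi ^ 2 * ‖ξ‖ ^ 2 := by positivity
        linarith
      have h3 : 1 + (2 * Real.pi / z.im) ^ 2 * ‖ξ‖ ^ 2 =
        (4 * Real.pi ^ 2 * ‖ξ‖ ^ 2 - -z.im ^ 2) / z.im ^ 2 := by field_simp; ring
      rw [h3]; field_simp
    rw [e]
    have h1 : (fun ξ : R3 => (1 + ‖(2 * Real.pi / z.im) • ξ‖ ^ 2) ^ (-1 : ℝ)).HasTemperateGrowth :=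
      (Function.hasTemperateGrowth_one_add_norm_sq_rpow R3 (-1)).comp
        (f := fun ξ : R3 => (2 * Real.pi / z.im) • ξ) (by fun_prop)
    fun_prop
  · set α : ℝ := (z ^ 2).re
    set β : ℝ := (z ^ 2).im with hβ
    have hβ0 : β ≠ 0 := by
      rw [hβ, pow_two, Complex.mul_im]
      have : z.re * z.im ≠ 0 := mul_ne_zero h0 hz
      intro h; apply this; linarith
    have e : (fun ξ => 1 / (lamSq ξ - z ^ 2)) = fun ξ : R3 => (lamSq ξ - (starRingEnd ℂ) (z ^ 2)) *
        (((1 / β ^ 2 : ℝ) : ℂ) *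
        (((1 + ‖(4 * Real.pi ^ 2 * ‖ξ‖ ^ 2 - α) / β‖ ^ 2) ^ (-1 : ℝ) : ℝ) : ℂ)) := by
      ext ξ
      have hz2 : z ^ 2 = (α : ℂ) + β * Complex.I := (Complex.re_add_im _).symm
      have hne := lamSq_sub_ne_zero hz ξ
      rw [div_eq_iff hne, lamSq_eq, hz2, ← Complex.ofReal_mul]
      set u : ℝ := 4 * Real.pi ^ 2 * ‖ξ‖ ^ 2
      have h1 : 1 / β ^ 2 * (1 + ‖(u - α) / β‖ ^ 2) ^ (-1:ℝ) = ((u - α) ^ 2 + β ^ 2)⁻¹ := by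
        have : (u - α) ^ 2 + β ^ 2 ≠ 0 := by positivity
        have h3 : 1 + ((u - α) / β) ^ 2 = ((u - α) ^ 2 + β ^ 2) / β ^ 2 := by field_simp; ring
        rw [Real.rpow_neg_one, Real.norm_eq_abs, sq_abs, h3]
        field_simp
      rw [h1]
      have h2 : (((u - α) ^ 2 + β ^ 2 : ℝ) : ℂ) ≠ 0 := by
        have : (u - α) ^ 2 + β ^ 2 ≠ 0 := by positivity
        exact_mod_cast this
      simp only [map_add, map_mul, Complex.conj_ofReal, Complex.conj_I]
      have h4 : ((u:ℂ) - (α + β * -Complex.I)) * ((u:ℂ) - (α + β * Complex.I)) =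
          (((u - α) ^ 2 + β ^ 2 : ℝ) : ℂ) := by
        push_cast
        linear_combination (-(β:ℂ) ^ 2) * Complex.I_sq
      rw [mul_right_comm, h4, Complex.ofReal_inv, mul_inv_cancel₀ h2]
    rw [e]
    have h1 : (fun ξ : R3 => (1 + ‖(4 * Real.pi ^ 2 * ‖ξ‖ ^ 2 - α) / β‖ ^ 2) ^ (-1 : ℝ)).HasTemperateGrowth := by
      refine (Function.hasTemperateGrowth_one_add_norm_sq_rpow ℝ (-1)).comp
        (f := fun ξ : R3 => (4 * Real.pi ^ 2 * ‖ξ‖ ^ 2 - α) / β) ?_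
      simp only [div_eq_mul_inv]
      fun_prop
    fun_prop

theorem hasTemperateGrowth_powSym {z : ℂ} (hz : z.im ≠ 0) (m : ℕ) :
    (fun ξ => powSym m (lamSq ξ) z).HasTemperateGrowth := by
  have hr := hasTemperateGrowth_resolvent hz
  induction m using Nat.twoStepInduction with
  | zero => simp only [powSym]; fun_prop
  | one => simp only [powSym]; exact hr
  | more m h1 h2 =>
    have : (fun ξ => powSym (m + 2) (lamSq ξ) z) = fun ξ =>
      (2 * z * powSym (m + 1) (lamSq ξ) z + powSym m (lamSq ξ) z) * (1 / (lamSq ξ - z ^ 2)) := by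
      ext ξ; rw [powSym]; ring
    rw [this]
    exact (((Function.HasTemperateGrowth.const (2 * z)).mul h2).add h1).mul hr

/-! ### Fourier transforms of all kernels -/

theorem hasDerivAt_fourier_kern (j : ℕ) {z : ℂ} (hz : 0 < z.im) (ξ : R3) :
    HasDerivAt (fun w => 𝓕 (kern j w) ξ) (Complex.I * 𝓕 (kern (j + 1) z) ξ) z := by
  simp only [Real.fourier_eq]
  rw [← integral_const_mul]
  -- On the half-plane `Im w > Im z / 2` the kernel at `b` dominates the `w`-derivative in modulus.
  set b : ℂ := ((z.im / 2 : ℝ) : ℂ) * Complex.I with hb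
  have hbim : b.im = z.im / 2 := by simp [hb]
  have hs : {w : ℂ | z.im / 2 < w.im} ∈ nhds z :=
    (isOpen_lt continuous_const Complex.continuous_im).mem_nhds (by simp; linarith)
  have hch : Continuous fun x : R3 => ((Real.fourierChar (-(inner ℝ x ξ)) : Circle) : ℂ) :=
    continuous_subtype_val.comp (Real.continuous_fourierChar.comp (by fun_prop))
  have hmeas : ∀ j w, AEStronglyMeasurable
      (fun x : R3 => Real.fourierChar (-(inner ℝ x ξ)) • kern j w x) volume := fun j w =>
    (hch.measurable.mul (measurable_kern j w)).aestronglyMeasurable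
  refine (hasDerivAt_integral_of_dominated_loc_of_deriv_le
    (F := fun w x => Real.fourierChar (-(inner ℝ x ξ)) • kern j w x)
    (F' := fun w x => Complex.I * (Real.fourierChar (-(inner ℝ x ξ)) • kern (j + 1) w x))
    (bound := fun x => ‖kern (j + 1) b x‖) hs (.of_forall fun w => hmeas j w) ?_ ?_ ?_ ?_ ?_).2
  · exact (Real.fourierIntegral_convergent_iff ξ).2 (integrable_kern j hz)
  · exact (hmeas (j + 1) z).const_mul Complex.I
  · refine .of_forall fun x w hw => ?_
    rw [norm_mul, Complex.norm_I, one_mul, Circle.smul_def, norm_smul, Circle.norm_coe, one_mul,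
      norm_kern, norm_kern, hbim]
    have : z.im / 2 < w.im := hw
    gcongr
  · exact (integrable_kern (j + 1) (by rw [hbim]; linarith)).norm
  · refine .of_forall fun x w _ => ?_
    have h1 : HasDerivAt (fun w : ℂ => Complex.exp (Complex.I * w * ‖x‖))
        (Complex.exp (Complex.I * w * ‖x‖) * (Complex.I * ‖x‖)) w := by
      have := (((hasDerivAt_id w).const_mul Complex.I).mul_const (‖x‖ : ℂ)).cexp
      simpa using this
    have h2 := ((h1.const_mul ((‖x‖ : ℂ) ^ j)).div_const (‖x‖ : ℂ)).const_mul
      ((Real.fourierChar (-(inner ℝ x ξ)) : Circle) : ℂ)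
    refine h2.congr_deriv ?_
    rw [Circle.smul_def, smul_eq_mul, kern]
    ring

/-- Differentiation in `z` multiplies the kernel by `ir` and sends `powSym (j+1)` to `(j+1) powSym
(j+2)`; comparing the two derivatives is the induction step. -/
theorem fourier_kern (j : ℕ) {z : ℂ} (hz : 0 < z.im) (ξ : R3) :
    𝓕 (kern j z) ξ = 4 * Real.pi * (-Complex.I) ^ j * j.factorial * powSym (j + 1) (lamSq ξ) z := by
  induction j generalizing z with
  | zero => rw [fourier_kern_zero hz]; simp [powSym, lamSq]; ring
  | succ j ih =>
    have h1 := hasDerivAt_fourier_kern j hz ξ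
    have h2 : HasDerivAt (fun w => 𝓕 (kern j w) ξ)
        (4 * Real.pi * (-Complex.I) ^ j * j.factorial *
          (((j + 1 : ℕ) : ℂ) * powSym (j + 1 + 1) (lamSq ξ) z)) z := by
      refine ((hasDerivAt_powSym (j + 1) (lamSq_sub_ne_zero hz.ne' ξ)).const_mul _).congr_of_eventuallyEq ?_
      filter_upwards [(isOpen_lt continuous_const Complex.continuous_im).mem_nhds hz] with w hw
      exact ih hw
    have h3 := h1.unique h2
    have h4 : 𝓕 (kern (j + 1) z) ξ = -Complex.I * (Complex.I * 𝓕 (kern (j + 1) z) ξ) := by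
      rw [← mul_assoc, neg_mul, Complex.I_mul_I]; ring
    rw [h4, h3, Nat.factorial_succ]
    push_cast
    ring

/-! ### Weighted Hilbert–Schmidt bounds for the resolvent kernels -/

/-- The modulus of the weighted kernel. -/
def wKern (a : ℝ) (j : ℕ) (x y : R3) : ℝ :=
  ‖jap (-a) x‖ * (‖x - y‖ ^ j / ‖x - y‖) * ‖jap (-a) y‖

theorem measurable_wKern (a : ℝ) (j : ℕ) : Measurable (Function.uncurry (wKern a j)) := by
  have h : Measurable (jap (-a)) := (hasTemperateGrowth_jap (-a)).1.continuous.measurable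
  unfold wKern Function.uncurry
  exact ((h.comp measurable_fst).norm.mul (by fun_prop)).mul (h.comp measurable_snd).norm

theorem lintegral_lt_top_of_le {k : R3 → R3 → ℝ} {u v g : R3 → ℝ} {C : ℝ}
    (hu : Integrable u) (hv : Integrable v) (hg : Integrable g) (hu0 : ∀ x, 0 ≤ u x)
    (h : ∀ x y, k x y ^ 2 ≤ C * (u x * v y + u x * g (x - y))) (hC : 0 ≤ C)
    (hk : ∀ x y, 0 ≤ k x y) :
    ∫⁻ x, ∫⁻ y, ENNReal.ofReal (k x y) ^ 2 < ∞ := by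
  have hv' : ∫⁻ y, ‖v y‖ₑ < ∞ := hv.2
  have hg' : ∫⁻ y, ‖g y‖ₑ < ∞ := hg.2
  have hu' : ∫⁻ y, ‖u y‖ₑ < ∞ := hu.2
  have h1 : ∀ x, ∫⁻ y, ENNReal.ofReal (k x y) ^ 2 ≤
      ENNReal.ofReal C * (‖u x‖ₑ * ((∫⁻ y, ‖v y‖ₑ) + ∫⁻ y, ‖g y‖ₑ)) := by
    intro x
    calc ∫⁻ y, ENNReal.ofReal (k x y) ^ 2
        ≤ ∫⁻ y, ENNReal.ofReal C * (‖u x‖ₑ * (‖v y‖ₑ + ‖g (x - y)‖ₑ)) := by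
          refine lintegral_mono fun y => ?_
          rw [← ENNReal.ofReal_pow (hk x y), mul_add]
          refine (ENNReal.ofReal_le_ofReal (h x y)).trans ?_
          rw [ENNReal.ofReal_mul hC]
          gcongr
          refine ENNReal.ofReal_add_le.trans ?_
          rw [ENNReal.ofReal_mul (hu0 x), ENNReal.ofReal_mul (hu0 x), Real.enorm_eq_ofReal (hu0 x)]
          gcongr <;> exact Real.ofReal_le_enorm _
      _ = _ := by
        rw [lintegral_const_mul' _ _ ENNReal.ofReal_ne_top,
          lintegral_const_mul' _ _ enorm_ne_top, lintegral_add_left' hv.1.enorm,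
          lintegral_sub_left_eq_self (fun y => ‖g y‖ₑ) x]
  refine lt_of_le_of_lt (lintegral_mono h1) ?_
  rw [lintegral_const_mul' _ _ ENNReal.ofReal_ne_top, lintegral_mul_const' _ _ (by finiteness)]
  finiteness

theorem integrable_one_add_norm_sq_rpow {q : ℝ} (hq : 3 / 2 < q) :
    Integrable fun x : R3 => (1 + ‖x‖ ^ 2) ^ (-q) := by
  have := integrable_rpow_neg_one_add_norm_sq (E := R3) (μ := volume) (r := 2 * q)
    (by rw [finrank_euclideanSpace]; norm_num; linarith)
  simpa [neg_div, mul_div_cancel_left₀] using this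

theorem integrable_inv_sq_mul {δ : ℝ} (hδ : 0 < δ) :
    Integrable fun x : R3 => (‖x‖ ^ 2)⁻¹ * (1 + ‖x‖ ^ 2) ^ (-(1 / 2 + δ)) := by
  refine (integrable_fun_norm_addHaar (volume : Measure R3)
      (f := fun r : ℝ => (r ^ 2)⁻¹ * (1 + r ^ 2) ^ (-(1 / 2 + δ)))).2 ?_
  have h := (integrable_rpow_neg_one_add_norm_sq (E := ℝ) (μ := volume) (r := 2 * (1 / 2 + δ))
    (by simp; linarith)).integrableOn (s := Set.Ioi 0)
  refine h.congr_fun (fun r hr => ?_) measurableSet_Ioi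
  have hr : (0:ℝ) < r := hr
  simp only [finrank_euclideanSpace, Fintype.card_fin, smul_eq_mul, Real.norm_eq_abs, sq_abs,
    Nat.add_one_sub_one]
  rw [← mul_assoc, mul_inv_cancel₀ (by positivity), one_mul]
  congr 1; ring

/-- When `|x - y|` is large compared with both points, `|x-y|⁻²` is at most a constant times
`⟨x⟩⁻¹⟨y⟩⁻¹`, and the bound separates in `x` and `y`. Otherwise `⟨x⟩` is controlled by `⟨y⟩` and
`⟨x-y⟩` by `⟨x⟩`, so decay can be traded for an integrable function of `x - y` that keeps the
singularity. -/
theorem wKern_zero_sq_le {δ : ℝ} (hδ : 0 < δ) (x y : R3) :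
    wKern (1 + δ) 0 x y ^ 2 ≤ (8 + 6 ^ (1 + δ) * 2 ^ (1 / 2 + δ)) *
      ((1 + ‖x‖ ^ 2) ^ (-(3 / 2 + δ)) * (1 + ‖y‖ ^ 2) ^ (-(3 / 2 + δ)) +
      (1 + ‖x‖ ^ 2) ^ (-(3 / 2 + δ)) *
        ((‖x - y‖ ^ 2)⁻¹ * (1 + ‖x - y‖ ^ 2) ^ (-(1 / 2 + δ)))) := by
  have hsq : ∀ w : R3, ‖jap (-(1 + δ)) w‖ ^ 2 = (1 + ‖w‖ ^ 2) ^ (-(1 + δ)) := fun w => by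
    rw [norm_jap, ← Real.rpow_natCast, ← Real.rpow_mul (by positivity)]; congr 1; push_cast; ring
  have e : wKern (1 + δ) 0 x y ^ 2 = (1 + ‖x‖ ^ 2) ^ (-(1 + δ)) * (1 + ‖y‖ ^ 2) ^ (-(1 + δ)) *
      (‖x - y‖ ^ 2)⁻¹ := by
    rw [wKern, mul_pow, mul_pow, hsq, hsq, pow_zero, one_div, inv_pow]; ring
  rw [e]
  set A : ℝ := 1 + ‖x‖ ^ 2 with hA
  set B : ℝ := 1 + ‖y‖ ^ 2 with hB
  set D : ℝ := 1 + ‖x - y‖ ^ 2 with hD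
  have hA1 : 1 ≤ A := by rw [hA]; nlinarith [norm_nonneg x]
  have hB1 : 1 ≤ B := by rw [hB]; nlinarith [norm_nonneg y]
  have hD1 : 1 ≤ D := by rw [hD]; nlinarith [norm_nonneg (x - y)]
  have hr : ‖x - y‖ ^ 2 = D - 1 := by rw [hD]; ring
  have hA0 : 0 < A := by linarith
  have hB0 : 0 < B := by linarith
  have hD0 : 0 < D := by linarith
  have hABD : A ≤ 2 * B + 2 * D := by
    have : ‖x‖ ≤ ‖x - y‖ + ‖y‖ := by simpa using norm_add_le (x - y) y
    rw [hA, hB, hD]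
    nlinarith [norm_nonneg x, norm_nonneg y, norm_nonneg (x - y), sq_nonneg (‖x - y‖ - ‖y‖)]
  have hBAD : B ≤ 2 * A + 2 * D := by
    have : ‖y‖ ≤ ‖x‖ + ‖x - y‖ := by
      have := norm_sub_le x (x - y)
      simpa using this
    rw [hA, hB, hD]
    nlinarith [norm_nonneg x, norm_nonneg y, norm_nonneg (x - y), sq_nonneg (‖x - y‖ - ‖x‖)]
  have hr0 : 0 ≤ (‖x - y‖ ^ 2)⁻¹ := by positivity
  have t1 : 0 ≤ A ^ (-(3 / 2 + δ)) * B ^ (-(3 / 2 + δ)) := by positivity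
  have t2 : 0 ≤ A ^ (-(3 / 2 + δ)) * ((‖x - y‖ ^ 2)⁻¹ * D ^ (-(1 / 2 + δ))) := by positivity
  have c1 : (0:ℝ) ≤ 6 ^ (1 + δ) * 2 ^ (1 / 2 + δ) := by positivity
  -- The condition `2 ≤ D` gives `|x-y|² = D - 1 ≥ D/2`, which yields the constant 8.
  by_cases hc : A / 4 ≤ D ∧ B / 4 ≤ D ∧ 2 ≤ D
  · obtain ⟨d1, d2, d3⟩ := hc
    have hi : (‖x - y‖ ^ 2)⁻¹ ≤ 8 * (A ^ (-(1 / 2) : ℝ) * B ^ (-(1 / 2) : ℝ)) := by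
      rw [← Real.mul_rpow hA0.le hB0.le, Real.rpow_neg (by positivity), ← Real.sqrt_eq_rpow, hr,
        ← div_eq_mul_inv, inv_eq_one_div, div_le_div_iff₀ (by linarith) (by positivity), one_mul]
      have : √(A * B) ≤ 4 * D := by
        rw [Real.sqrt_le_left (by positivity)]
        nlinarith
      linarith
    calc A ^ (-(1 + δ)) * B ^ (-(1 + δ)) * (‖x - y‖ ^ 2)⁻¹
        ≤ A ^ (-(1 + δ)) * B ^ (-(1 + δ)) * (8 * (A ^ (-(1 / 2) : ℝ) * B ^ (-(1 / 2) : ℝ))) := by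
          gcongr
      _ = 8 * ((A ^ (-(1 + δ)) * A ^ (-(1 / 2) : ℝ)) * (B ^ (-(1 + δ)) * B ^ (-(1 / 2) : ℝ))) := by
          ring
      _ = 8 * (A ^ (-(3 / 2 + δ)) * B ^ (-(3 / 2 + δ))) := by
          rw [← Real.rpow_add hA0, ← Real.rpow_add hB0]; ring_nf
      _ ≤ _ := by nlinarith
  -- The worst case for the first bound is `D < 2`, where `A ≤ 2B + 2D < 2B + 4 ≤ 6B`.
  · have key : A / 6 ≤ B ∧ D / 2 ≤ A := by
      by_cases d1 : A / 4 ≤ D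
      · by_cases d2 : B / 4 ≤ D
        · have d3 : D < 2 := by
            by_contra! h; exact hc ⟨d1, d2, h⟩
          constructor <;> linarith
        · constructor <;> linarith
      · constructor <;> linarith
    obtain ⟨k1, k2⟩ := key
    have i1 : B ^ (-(1 + δ)) ≤ 6 ^ (1 + δ) * A ^ (-(1 + δ)) := by
      calc B ^ (-(1 + δ)) ≤ (A / 6) ^ (-(1 + δ)) :=
            Real.rpow_le_rpow_of_nonpos (by positivity) k1 (by linarith)
        _ = _ := by
          rw [Real.div_rpow hA0.le (by norm_num), Real.rpow_neg (by norm_num : (0:ℝ) ≤ 6),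
            div_inv_eq_mul, mul_comm]
    have i2 : A ^ (-(1 / 2 + δ)) ≤ 2 ^ (1 / 2 + δ) * D ^ (-(1 / 2 + δ)) := by
      calc A ^ (-(1 / 2 + δ)) ≤ (D / 2) ^ (-(1 / 2 + δ)) :=
            Real.rpow_le_rpow_of_nonpos (by positivity) k2 (by linarith)
        _ = _ := by
          rw [Real.div_rpow hD0.le (by norm_num), Real.rpow_neg (by norm_num : (0:ℝ) ≤ 2),
            div_inv_eq_mul, mul_comm]
    have e2 : A ^ (-(1 + δ)) * A ^ (-(1 + δ)) = A ^ (-(3 / 2 + δ)) * A ^ (-(1 / 2 + δ)) := by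
      rw [← Real.rpow_add hA0, ← Real.rpow_add hA0]; congr 1; ring
    calc A ^ (-(1 + δ)) * B ^ (-(1 + δ)) * (‖x - y‖ ^ 2)⁻¹
        ≤ A ^ (-(1 + δ)) * (6 ^ (1 + δ) * A ^ (-(1 + δ))) * (‖x - y‖ ^ 2)⁻¹ := by gcongr
      _ = 6 ^ (1 + δ) * (A ^ (-(1 + δ)) * A ^ (-(1 + δ))) * (‖x - y‖ ^ 2)⁻¹ := by ring
      _ = 6 ^ (1 + δ) * (A ^ (-(3 / 2 + δ)) * A ^ (-(1 / 2 + δ))) * (‖x - y‖ ^ 2)⁻¹ := by rw [e2]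
      _ ≤ 6 ^ (1 + δ) * (A ^ (-(3 / 2 + δ)) * (2 ^ (1 / 2 + δ) * D ^ (-(1 / 2 + δ)))) *
          (‖x - y‖ ^ 2)⁻¹ := by gcongr
      _ = 6 ^ (1 + δ) * 2 ^ (1 / 2 + δ) *
          (A ^ (-(3 / 2 + δ)) * ((‖x - y‖ ^ 2)⁻¹ * D ^ (-(1 / 2 + δ)))) := by ring
      _ ≤ _ := by nlinarith

/-- Without the singularity the growth `|x-y|^j` can be shared between `⟨x⟩^j` and `⟨y⟩^j` by
Peetre's inequality. Square integrability then needs `a - j > 3/2`. -/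
theorem wKern_succ_le (a : ℝ) (j : ℕ) (x y : R3) :
    wKern a (j + 1) x y ≤ 2 ^ ((j:ℝ) / 2) * (‖jap (-(a - j)) x‖ * ‖jap (-(a - j)) y‖) := by
  have h1 : ‖x - y‖ ^ (j + 1) / ‖x - y‖ ≤ ‖jap j (x - y)‖ := by
    have h2 : ‖x - y‖ ^ (j + 1) / ‖x - y‖ ≤ ‖x - y‖ ^ j := by
      rw [pow_succ, mul_div_assoc]
      exact mul_le_of_le_one_right (by positivity) (div_self_le_one _)
    refine h2.trans ?_
    rw [norm_jap, ← Real.rpow_natCast]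
    have h3 : ‖x - y‖ ≤ (1 + ‖x - y‖ ^ 2) ^ (1 / 2 : ℝ) := by
      rw [← Real.sqrt_eq_rpow]
      exact Real.le_sqrt_of_sq_le (by linarith)
    calc ‖x - y‖ ^ (j:ℝ) ≤ ((1 + ‖x - y‖ ^ 2) ^ (1 / 2 : ℝ)) ^ (j:ℝ) := by gcongr
      _ = _ := by rw [← Real.rpow_mul (by positivity)]; congr 1; ring
  have h4 := norm_jap_mul_le (-(j:ℝ)) x y
  rw [neg_neg, abs_neg, abs_of_nonneg (Nat.cast_nonneg j)] at h4
  have e1 : ∀ w, ‖jap (-(a - j)) w‖ = ‖jap (-a) w‖ * ‖jap j w‖ := fun w => by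
    rw [← norm_mul, ← jap_add_apply]; congr 2; ring
  have e2 : ‖jap j x‖ * ‖jap (-(j:ℝ)) x‖ = 1 := by
    rw [← norm_mul, ← jap_add_apply, add_neg_cancel, jap_zero]; simp
  have h5 : ‖jap j (x - y)‖ ≤ 2 ^ ((j:ℝ) / 2) * (‖jap j x‖ * ‖jap j y‖) := by
    calc ‖jap j (x - y)‖ = ‖jap j x‖ * (‖jap (-(j:ℝ)) x‖ * ‖jap j (x - y)‖) := by
          rw [← mul_assoc, e2, one_mul]
      _ ≤ ‖jap j x‖ * (2 ^ ((j:ℝ) / 2) * ‖jap j y‖) := by gcongr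
      _ = _ := by ring
  rw [e1, e1, wKern]
  calc _ ≤ ‖jap (-a) x‖ * (2 ^ ((j:ℝ) / 2) * (‖jap j x‖ * ‖jap j y‖)) * ‖jap (-a) y‖ := by
        gcongr; exact h1.trans h5
    _ = _ := by ring

theorem wKern_nonneg (a : ℝ) (j : ℕ) (x y : R3) : 0 ≤ wKern a j x y := by
  unfold wKern; positivity

/-- Source of the exponent `κ`: for `j = 0` the slow decay `1/r` requires `a > 1`, and for `j ≥ 1`
the growth `r^{j-1}` requires `a > j + 1/2`. -/
theorem exists_lintegral_wKern_le {a : ℝ} (j : ℕ) (ha : 1 < a) (haj : (j:ℝ) + 1 / 2 < a) :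
    ∃ A : ℝ, 0 ≤ A ∧ ∫⁻ x, ∫⁻ y, ENNReal.ofReal (wKern a j x y) ^ 2 ≤ ENNReal.ofReal A ^ 2 := by
  have fin : ∫⁻ x, ∫⁻ y, ENNReal.ofReal (wKern a j x y) ^ 2 < ∞ := by
    rcases j with _ | j
    · obtain ⟨δ, rfl⟩ : ∃ δ, a = 1 + δ := ⟨a - 1, by ring⟩
      have hδ : 0 < δ := by linarith
      exact lintegral_lt_top_of_le (integrable_one_add_norm_sq_rpow (by linarith))
        (integrable_one_add_norm_sq_rpow (by linarith)) (integrable_inv_sq_mul hδ)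
        (fun x => by positivity) (wKern_zero_sq_le hδ) (by positivity) (wKern_nonneg _ _)
    · push_cast at haj
      have hq : 3 / 2 < a - j := by linarith
      refine lintegral_lt_top_of_le (C := (2 ^ ((j:ℝ) / 2)) ^ 2)
        (integrable_one_add_norm_sq_rpow hq)
        (integrable_one_add_norm_sq_rpow hq) (integrable_zero R3 ℝ volume)
        (fun x => by positivity) (fun x y => ?_) (by positivity) (wKern_nonneg _ _)
      have hsq : ∀ w : R3, ‖jap (-(a - j)) w‖ ^ 2 = (1 + ‖w‖ ^ 2) ^ (-(a - j)) := fun w => by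
        rw [norm_jap, ← Real.rpow_natCast, ← Real.rpow_mul (by positivity)]
        congr 1; push_cast; ring
      rw [Pi.zero_apply, mul_zero, add_zero, ← hsq, ← hsq, ← mul_pow, ← mul_pow]
      exact pow_le_pow_left₀ (wKern_nonneg _ _ _ _) (wKern_succ_le a j x y) 2
  refine ⟨√(∫⁻ x, ∫⁻ y, ENNReal.ofReal (wKern a j x y) ^ 2).toReal, Real.sqrt_nonneg _, ?_⟩
  rw [← ENNReal.ofReal_pow (Real.sqrt_nonneg _), Real.sq_sqrt ENNReal.toReal_nonneg,
    ENNReal.ofReal_toReal fin.ne]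

theorem nm_weight_powSym_le_of_im_pos {a A : ℝ} (j : ℕ) (hA : 0 ≤ A)
    (h : ∫⁻ x, ∫⁻ y, ENNReal.ofReal (wKern a j x y) ^ 2 ≤ ENNReal.ofReal A ^ 2)
    {z : ℂ} (hz : 0 < z.im) (f : 𝓢(R3, ℂ)) :
    nm (mulOp (jap (-a)) (multOp (fun ξ => powSym (j + 1) (lamSq ξ) z)
      (mulOp (jap (-a)) f))) ≤ A * nm f := by
  set c : ℂ := 4 * Real.pi * (-Complex.I) ^ j * j.factorial with hc
  have hcn : ‖c‖ = 4 * Real.pi * j.factorial := by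
    rw [hc]
    simp [abs_of_pos Real.pi_pos]
  -- The normalising constant has modulus `4π j! ≥ 1`, so dividing by it can be ignored.
  have hc1 : 1 ≤ ‖c‖ := by
    rw [hcn]
    have h1 : (1:ℝ) ≤ j.factorial := by exact_mod_cast j.factorial_pos
    have h2 := Real.pi_gt_three
    nlinarith
  have hc0 : c ≠ 0 := norm_pos_iff.1 (by linarith)
  have hf : ∀ ξ, 𝓕 (c⁻¹ • kern j z) ξ = powSym (j + 1) (lamSq ξ) z := by
    intro ξ
    rw [Real.fourier_eq]
    have : ∀ v : R3, Real.fourierChar (-(inner ℝ v ξ)) • (c⁻¹ • kern j z) v =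
        c⁻¹ * (Real.fourierChar (-(inner ℝ v ξ)) • kern j z v) := fun v => by
      simp only [Circle.smul_def, Pi.smul_apply, smul_eq_mul]; ring
    simp_rw [this]
    rw [integral_const_mul, ← Real.fourier_eq, fourier_kern j hz, ← hc, inv_mul_cancel_left₀ hc0]
  refine nm_le_of_hilbertSchmidt hA (fun x => ?_) h fun x => ?_
  · exact ((measurable_wKern a j).of_uncurry_left (x := x)).ennreal_ofReal.aemeasurable
  · rw [mulOp_apply (by fun_prop), multOp_apply_eq_integral ((integrable_kern j hz).smul c⁻¹)
      (hasTemperateGrowth_powSym hz.ne' (j + 1)) hf, ← integral_const_mul]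
    rw [← integral_sub_left_eq_self _ volume x]
    refine (enorm_integral_le_lintegral_enorm _).trans (lintegral_mono fun y => ?_)
    rw [sub_sub_cancel, mulOp_apply (by fun_prop), ← ofReal_norm, ← ofReal_norm (f y),
      ← ENNReal.ofReal_mul (wKern_nonneg _ _ _ _)]
    apply ENNReal.ofReal_le_ofReal
    rw [norm_mul, norm_mul, norm_mul, Pi.smul_apply, norm_smul, norm_kern, norm_inv, wKern]
    have e1 : Real.exp (-(z.im * ‖x - y‖)) ≤ 1 := Real.exp_le_one_iff.2 (by
      have := mul_nonneg hz.le (norm_nonneg (x - y)); linarith)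
    have e2 : ‖c‖⁻¹ ≤ 1 := inv_le_one_of_one_le₀ hc1
    calc _ ≤ ‖jap (-a) x‖ * (1 * (‖x - y‖ ^ j * 1 / ‖x - y‖) * (‖jap (-a) y‖ * ‖f y‖)) := by
          gcongr
      _ = _ := by ring

/-- Uniform weighted `L²` bounds for the symbols of the resolvent powers. -/
theorem exists_nm_weight_powSym_le {a : ℝ} (m : ℕ) (ha : 1 < a) (ham : (m:ℝ) - 1 / 2 < a) :
    ∃ A : ℝ, 0 ≤ A ∧ ∀ z : ℂ, z.im ≠ 0 → ∀ f : 𝓢(R3, ℂ),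
      nm (mulOp (jap (-a)) (multOp (fun ξ => powSym m (lamSq ξ) z)
        (mulOp (jap (-a)) f))) ≤ A * nm f := by
  rcases m with _ | j
  · refine ⟨0, le_rfl, fun z _ f => ?_⟩
    have e : multOp (fun ξ => powSym 0 (lamSq ξ) z) (mulOp (jap (-a)) f) = (0:ℂ) • 0 := by
      simp only [powSym]
      rw [multOp, SchwartzMap.fourierMultiplierCLM_const, zero_smul, zero_smul, zero_apply]
    rw [e, map_smul, nm_smul, norm_zero, zero_mul, zero_mul]
  · obtain ⟨A, hA, h⟩ := exists_lintegral_wKern_le j ha (by push_cast at ham; linarith)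
    refine ⟨A, hA, fun z hz f => ?_⟩
    rcases lt_or_gt_of_ne hz with hz' | hz'
    · have e : (fun ξ => powSym (j + 1) (lamSq ξ) z) =
          ((-1) ^ (j + 1 + 1) : ℂ) • fun ξ => powSym (j + 1) (lamSq ξ) (-z) := by
        ext ξ
        rw [Pi.smul_apply, smul_eq_mul, ← powSym_neg, neg_neg]
      have hz'' : 0 < (-z).im := by simpa using hz'
      rw [e, multOp_smul (hasTemperateGrowth_powSym hz''.ne' _), map_smul, nm_smul]
      simpa using nm_weight_powSym_le_of_im_pos j hA h hz'' f
    · exact nm_weight_powSym_le_of_im_pos j hA h hz' f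

/-! ### Combining low and high frequencies -/

theorem exists_cutoff (R : ℝ) (hR : 0 < R) : ∃ Q : 𝓢(R3, ℂ),
    (∀ x, (starRingEnd ℂ) (Q x) = Q x) ∧ (∀ x, ‖1 - Q x * Q x‖ ≤ 1) ∧
    ∀ x, ‖x‖ ≤ R → Q x = 1 := by
  let b : ContDiffBump (0 : R3) := ⟨R, R + 1, hR, by linarith⟩
  have hc : HasCompactSupport fun x => ((b x : ℝ) : ℂ) :=
    b.hasCompactSupport.comp_left (g := fun r : ℝ => (r : ℂ)) (by simp)
  have hs : ContDiff ℝ (⊤ : ℕ∞) fun x => ((b x : ℝ) : ℂ) :=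
    Complex.ofRealCLM.contDiff.comp b.contDiff
  refine ⟨hc.toSchwartzMap hs, fun x => Complex.conj_ofReal _, fun x => ?_, fun x hx => ?_⟩
  · change ‖1 - ((b x : ℝ) : ℂ) * ((b x : ℝ) : ℂ)‖ ≤ 1
    rw [← Complex.ofReal_one, ← Complex.ofReal_mul, ← Complex.ofReal_sub, Complex.norm_real,
      Real.norm_eq_abs, abs_le]
    have h0 := b.nonneg (x := x)
    have h1 := b.le_one (x := x)
    constructor <;> nlinarith
  · change ((b x : ℝ) : ℂ) = 1
    rw [b.one_of_mem_closedBall (by simpa using hx), Complex.ofReal_one]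

/-- A Fourier multiplier bounded between weighted `L²` spaces and of order `-p` at high frequencies
is bounded between weighted Sobolev spaces. -/
theorem exists_nm_sobolev_le (R : ℝ) (hR : 0 < R) (a : ℝ) (ha : 0 < a) (s p : ℝ) :
    ∃ B : ℝ, 0 ≤ B ∧ ∀ m : R3 → ℂ, m.HasTemperateGrowth → ∀ A : ℝ, 0 ≤ A →
      (∀ ξ, R ≤ ‖ξ‖ → ‖m ξ‖ ≤ A * ‖jap (-p) ξ‖) →
      (∀ f, nm (mulOp (jap (-a)) (multOp m (mulOp (jap (-a)) f))) ≤ A * nm f) →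
      ∀ f, nm (multOp (jap (s + p)) (mulOp (jap (-a)) (multOp m (mulOp (jap (-a))
        (multOp (jap (-s)) f))))) ≤ B * A * nm f := by
  obtain ⟨Q, hQr, hQ1, hQ⟩ := exists_cutoff R hR
  have hQt := Q.hasTemperateGrowth
  obtain ⟨L₁, hL₁, l1⟩ := exists_nm_low_le' Q hQr a (s + p)
  obtain ⟨L₂, hL₂, l2⟩ := exists_nm_low_le Q a (-s)
  obtain ⟨H₁, hH₁, h1⟩ := exists_nm_weight_le a ha (s + p)
  obtain ⟨H₂, hH₂, h2⟩ := exists_nm_weight_le a ha s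
  refine ⟨L₁ * L₂ + H₁ * H₂, by positivity, fun m hm A hA hhigh hlow f => ?_⟩
  set mh : R3 → ℂ := fun ξ => (1 - Q ξ * Q ξ) * m ξ with hmh
  have hmht : mh.HasTemperateGrowth := by fun_prop
  -- Writing `1 = Q² + (1 - Q²)` puts a cutoff on each side of the low part, so both the source and
  -- the target Sobolev orders can be absorbed there.
  have split : ∀ u, multOp m u = multOp Q (multOp m (multOp Q u)) + multOp mh u := by
    intro u
    rw [multOp_multOp hm hQt, multOp_multOp hQt (hm.mul hQt),
      ← multOp_add (hQt.mul (hm.mul hQt)) hmht]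
    congr 2
    ext ξ
    simp only [hmh, Pi.add_apply, Pi.mul_apply]
    ring
  rw [split, map_add, map_add]
  refine (nm_add_le _ _).trans ?_
  have low : nm (multOp (jap (s + p)) (mulOp (jap (-a)) (multOp Q (multOp m (multOp Q
      (mulOp (jap (-a)) (multOp (jap (-s)) f))))))) ≤ L₁ * L₂ * A * nm f := by
    have e : ∀ u, mulOp (jap a) (mulOp (jap (-a)) u) = u := fun u => by
      rw [mulOp_jap_jap, add_neg_cancel, mulOp_jap_zero]
    have e' : ∀ u, mulOp (jap (-a)) (mulOp (jap a) u) = u := fun u => by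
      rw [mulOp_jap_jap, neg_add_cancel, mulOp_jap_zero]
    -- Inserting `⟨x⟩^{a}⟨x⟩^{-a}` on both sides of `m` isolates the weighted `L²` operator between
    -- two smoothing cutoffs.
    have i1 := l1 (mulOp (jap (-a)) (multOp m (multOp Q (mulOp (jap (-a)) (multOp (jap (-s)) f)))))
    rw [e] at i1
    have i2 := hlow (mulOp (jap a) (multOp Q (mulOp (jap (-a)) (multOp (jap (-s)) f))))
    rw [e'] at i2
    calc _ ≤ _ := i1
      _ ≤ L₁ * (A * (L₂ * nm f)) := by
        gcongr
        refine i2.trans ?_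
        gcongr
        exact l2 f
      _ = _ := by ring
  have high : nm (multOp (jap (s + p)) (mulOp (jap (-a)) (multOp mh
      (mulOp (jap (-a)) (multOp (jap (-s)) f))))) ≤ H₁ * H₂ * A * nm f := by
    set u := mulOp (jap (-a)) (multOp (jap (-s)) f) with hu
    -- The middle symbol `⟨ξ⟩^p mh` is bounded, and each outer power of `⟨D⟩` completes the
    -- conjugation of a weight, of orders `s + p` and `s`.
    have e1 : multOp mh u = multOp (jap (-(s + p))) (multOp (jap p * mh) (multOp (jap s) u)) := by
      rw [multOp_multOp (by fun_prop) (by fun_prop), multOp_multOp (by fun_prop) (by fun_prop)]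
      congr 2
      ext ξ
      have : jap (-(s + p)) ξ * jap p ξ * jap s ξ = 1 := by
        rw [← jap_add_apply, ← jap_add_apply, show -(s + p) + p + s = 0 by ring, jap_zero]
      simp only [Pi.mul_apply]
      linear_combination (-mh ξ) * this
    have i1 : nm (multOp (jap p * mh) (multOp (jap s) u)) ≤ A * nm (multOp (jap s) u) := by
      refine nm_multOp_le (by fun_prop) hA (fun ξ => ?_) _
      rw [Pi.mul_apply, norm_mul, hmh]
      beta_reduce
      rcases le_total ‖ξ‖ R with hξ | hξ
      · rw [hQ ξ hξ]; simpa using hA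
      · have hj : ‖jap p ξ‖ * ‖jap (-p) ξ‖ = 1 := by
          rw [← norm_mul, ← jap_add_apply, add_neg_cancel, jap_zero]; simp
        calc ‖jap p ξ‖ * ‖(1 - Q ξ * Q ξ) * m ξ‖ ≤ ‖jap p ξ‖ * (1 * (A * ‖jap (-p) ξ‖)) := by
              rw [norm_mul]; gcongr
              · exact hQ1 ξ
              · exact hhigh ξ hξ
          _ = A * (‖jap p ξ‖ * ‖jap (-p) ξ‖) := by ring
          _ = A := by rw [hj, mul_one]
    rw [e1]
    calc _ ≤ _ := h1 _
      _ ≤ H₁ * (A * (H₂ * nm f)) := by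
        gcongr
        refine i1.trans ?_
        gcongr
        exact h2 f
      _ = _ := by ring
  calc _ ≤ _ := add_le_add low high
    _ = _ := by ring

/-! ### Bounds for the entries of the resolvent powers -/

/-- The diagonal entries of the symbol of `(G₀ - z)^{-(n+1)}`. -/
def diagSym (n : ℕ) (z : ℂ) (ξ : R3) : ℂ :=
  powSym n (lamSq ξ) z + z * powSym (n + 1) (lamSq ξ) z

/-- The off-diagonal part of the symbol of `(G₀ - z)^{-(n+1)}`. -/
def offSym (n : ℕ) (z : ℂ) (ξ : R3) : ℂ := powSym (n + 1) (lamSq ξ) z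

theorem hasTemperateGrowth_diagSym (n : ℕ) {z : ℂ} (hz : z.im ≠ 0) :
    (diagSym n z).HasTemperateGrowth :=
  (hasTemperateGrowth_powSym hz n).add
    ((Function.HasTemperateGrowth.const z).mul (hasTemperateGrowth_powSym hz (n + 1)))

theorem hasTemperateGrowth_offSym (n : ℕ) {z : ℂ} (hz : z.im ≠ 0) :
    (offSym n z).HasTemperateGrowth := hasTemperateGrowth_powSym hz (n + 1)

/-- A family of symbols that is uniformly bounded on weighted `L²` for `|z| ≤ C`. -/
def LowBdd (a C : ℝ) (m : ℂ → R3 → ℂ) : Prop :=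
  (∀ z : ℂ, z.im ≠ 0 → (m z).HasTemperateGrowth) ∧ ∃ A : ℝ, 0 ≤ A ∧ ∀ z : ℂ, z.im ≠ 0 → ‖z‖ ≤ C →
    ∀ f, nm (mulOp (jap (-a)) (multOp (m z) (mulOp (jap (-a)) f))) ≤ A * nm f

theorem LowBdd.add {a C : ℝ} {m m' : ℂ → R3 → ℂ} (h : LowBdd a C m) (h' : LowBdd a C m') :
    LowBdd a C (fun z => m z + m' z) := by
  obtain ⟨ht, A, hA, h⟩ := h
  obtain ⟨ht', A', hA', h'⟩ := h'
  refine ⟨fun z hz => (ht z hz).add (ht' z hz), A + A', by positivity, fun z hz hzC f => ?_⟩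
  rw [multOp_add (ht z hz) (ht' z hz), map_add, add_mul]
  exact (nm_add_le _ _).trans (add_le_add (h z hz hzC f) (h' z hz hzC f))

theorem LowBdd.smul {a C : ℝ} {m : ℂ → R3 → ℂ} (h : LowBdd a C m) {c : ℂ → ℂ} {K : ℝ}
    (hK : 0 ≤ K) (hc : ∀ z, ‖z‖ ≤ C → ‖c z‖ ≤ K) : LowBdd a C (fun z => c z • m z) := by
  obtain ⟨ht, A, hA, h⟩ := h
  refine ⟨fun z hz => (Function.HasTemperateGrowth.const (c z)).mul (ht z hz), K * A,
    by positivity, fun z hz hzC f => ?_⟩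
  rw [multOp_smul (ht z hz), map_smul, nm_smul, mul_assoc]
  exact mul_le_mul (hc z hzC) (h z hz hzC f) (nm_nonneg _) hK

theorem lowBdd_powSym {a C : ℝ} (m : ℕ) (ha : 1 < a) (ham : (m:ℝ) - 1 / 2 < a) :
    LowBdd a C (fun z ξ => powSym m (lamSq ξ) z) := by
  obtain ⟨A, hA, h⟩ := exists_nm_weight_powSym_le m ha ham
  exact ⟨fun z hz => hasTemperateGrowth_powSym hz m, A, hA, fun z hz _ f => h z hz f⟩

theorem lowBdd_one {a C : ℝ} (ha : 0 ≤ a) : LowBdd a C (fun _ _ => 1) := by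
  refine ⟨fun z _ => by fun_prop, 1, zero_le_one, fun z _ _ f => ?_⟩
  have e : multOp (fun _ => (1:ℂ)) (mulOp (jap (-a)) f) = mulOp (jap (-a)) f := by
    rw [← jap_zero, multOp_jap_zero]
  rw [e, mulOp_jap_jap]
  refine nm_mulOp_le (by fun_prop) zero_le_one (fun x => ?_) f
  rw [norm_jap]
  exact Real.rpow_le_one_of_one_le_of_nonpos (by nlinarith [norm_nonneg x]) (by linarith)

theorem LowBdd.congr {a C : ℝ} {m m' : ℂ → R3 → ℂ} (h : LowBdd a C m)
    (e : ∀ z : ℂ, z.im ≠ 0 → m z = m' z) : LowBdd a C m' := by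
  obtain ⟨ht, A, hA, h⟩ := h
  refine ⟨fun z hz => e z hz ▸ ht z hz, A, hA, fun z hz hzC f => ?_⟩
  rw [← e z hz]; exact h z hz hzC f

theorem lowBdd_offSym {a C : ℝ} (n : ℕ) (ha : 1 < a) (han : (n:ℝ) + 1 / 2 < a) :
    LowBdd a C (offSym n) :=
  lowBdd_powSym (n + 1) ha (by push_cast; linarith)

theorem lowBdd_diagSym {a C : ℝ} (hC : 0 ≤ C) (n : ℕ) (ha : 1 < a) (han : (n:ℝ) + 1 / 2 < a) :
    LowBdd a C (diagSym n) :=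
  (lowBdd_powSym n ha (by linarith)).add ((lowBdd_offSym n ha han).smul (c := fun z => z) hC
    fun _ h => h)

theorem lamSq_mul_offSym_zero {z : ℂ} (hz : z.im ≠ 0) (ξ : R3) :
    lamSq ξ * offSym 0 z ξ = z ^ 2 * offSym 0 z ξ + 1 := by
  have h := lamSq_sub_ne_zero hz ξ
  simp only [offSym, powSym]
  field_simp
  ring

theorem lamSq_mul_offSym_succ {z : ℂ} (hz : z.im ≠ 0) (n : ℕ) (ξ : R3) :
    lamSq ξ * offSym (n + 1) z ξ = z ^ 2 * offSym (n + 1) z ξ +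
      (2 * z * offSym n z ξ + powSym n (lamSq ξ) z) := by
  have h := lamSq_sub_ne_zero hz ξ
  have e : offSym (n + 1) z ξ =
    (2 * z * offSym n z ξ + powSym n (lamSq ξ) z) / (lamSq ξ - z ^ 2) := by
    rw [offSym, powSym]; rfl
  rw [e]
  field_simp
  ring

theorem norm_sq_le {C : ℝ} (z : ℂ) (h : ‖z‖ ≤ C) : ‖z ^ 2‖ ≤ C ^ 2 := by
  rw [norm_pow]; gcongr

/-- Writing `λ² = z² + (λ² - z²)` cancels the denominator and leaves symbols already bounded, with
coefficients bounded for `|z| ≤ C`. For `n = 0` the remainder is the identity, which has no function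
kernel but is harmless between decaying weights. -/
theorem lowBdd_lamSq_mul_offSym {a C : ℝ} (hC : 0 ≤ C) (n : ℕ) (ha : 1 < a)
    (han : (n:ℝ) + 1 / 2 < a) : LowBdd a C (fun z => lamSq * offSym n z) := by
  rcases n with _ | n
  · refine (((lowBdd_offSym 0 ha han).smul (c := fun z => z ^ 2) (K := C ^ 2) (by positivity)
      norm_sq_le).add (lowBdd_one (by linarith))).congr fun z hz => ?_
    ext ξ
    exact (lamSq_mul_offSym_zero hz ξ).symm
  · push_cast at han
    refine (((lowBdd_offSym (n + 1) ha (by push_cast; linarith)).smul (c := fun z => z ^ 2)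
      (K := C ^ 2) (by positivity) norm_sq_le).add
      (((lowBdd_offSym n ha (by linarith)).smul (c := fun z => 2 * z) (K := 2 * C) (by positivity)
      (fun z h => by rw [norm_mul]; simpa using h)).add
      (lowBdd_powSym n ha (by linarith)))).congr fun z hz => ?_
    ext ξ
    exact (lamSq_mul_offSym_succ hz n ξ).symm

/-- For `|ξ| ≥ C + 1` one has `|λ² - z²| ≥ 4π²|ξ|² - C² ≥ |ξ|²`, also for real `z`; each step of the
recursion gains this factor. -/
theorem exists_norm_powSym_le {C : ℝ} (hC : 0 ≤ C) (m : ℕ) : ∃ K : ℝ, 0 ≤ K ∧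
    ∀ z : ℂ, ‖z‖ ≤ C → ∀ ξ : R3, C + 1 ≤ ‖ξ‖ → ‖powSym m (lamSq ξ) z‖ ≤ K * (‖ξ‖ ^ (m + 1))⁻¹ := by
  have hden : ∀ z : ℂ, ‖z‖ ≤ C → ∀ ξ : R3, C + 1 ≤ ‖ξ‖ → ‖ξ‖ ^ 2 ≤ ‖lamSq ξ - z ^ 2‖ := by
    intro z hz ξ hξ
    have h1 : ‖lamSq ξ‖ = 4 * Real.pi ^ 2 * ‖ξ‖ ^ 2 := by
      rw [lamSq_eq, Complex.norm_real, Real.norm_of_nonneg (by positivity)]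
    have h2 := norm_sub_norm_le (lamSq ξ) (z ^ 2)
    have h3 := norm_sq_le z hz
    have h4 : C ^ 2 ≤ ‖ξ‖ ^ 2 := by gcongr; linarith
    have h5 : 9 ≤ Real.pi ^ 2 := by nlinarith [Real.pi_gt_three]
    rw [h1] at h2
    nlinarith [sq_nonneg ‖ξ‖]
  induction m using Nat.twoStepInduction with
  | zero => exact ⟨0, le_rfl, fun z _ ξ _ => by simp [powSym]⟩
  | one =>
    refine ⟨1, zero_le_one, fun z hz ξ hξ => ?_⟩
    have hp : 0 < ‖ξ‖ := by linarith
    rw [powSym, norm_div, norm_one, one_div, one_mul]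
    exact inv_anti₀ (by positivity) (hden z hz ξ hξ)
  | more m h1 h2 =>
    obtain ⟨K₁, hK₁, h1⟩ := h1
    obtain ⟨K₂, hK₂, h2⟩ := h2
    refine ⟨2 * C * K₂ + K₁, by positivity, fun z hz ξ hξ => ?_⟩
    have hp : 0 < ‖ξ‖ := by linarith
    have hp1 : 1 ≤ ‖ξ‖ := by linarith
    have hd := hden z hz ξ hξ
    rw [powSym, norm_div]
    have i1 : ‖2 * z * powSym (m + 1) (lamSq ξ) z + powSym m (lamSq ξ) z‖ ≤
        (2 * C * K₂ + K₁) * (‖ξ‖ ^ (m + 1))⁻¹ := by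
      refine (norm_add_le _ _).trans ?_
      rw [add_mul, norm_mul, norm_mul, Complex.norm_two, mul_assoc (2 * C)]
      have i2 : ‖powSym (m + 1) (lamSq ξ) z‖ ≤ K₂ * (‖ξ‖ ^ (m + 1))⁻¹ := by
        refine (h2 z hz ξ hξ).trans ?_
        gcongr
        omega
      gcongr
      exact h1 z hz ξ hξ
    calc _ ≤ (2 * C * K₂ + K₁) * (‖ξ‖ ^ (m + 1))⁻¹ / ‖ξ‖ ^ 2 := by gcongr
      _ = _ := by
        rw [show m + 2 + 1 = (m + 1) + 2 from by ring, pow_add _ (m + 1), mul_inv, div_eq_mul_inv,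
          mul_assoc]

theorem inv_pow_le_norm_jap (q : ℕ) {ξ : R3} (hξ : 1 ≤ ‖ξ‖) :
    (‖ξ‖ ^ q)⁻¹ ≤ 2 ^ ((q:ℝ) / 2) * ‖jap (-(q:ℝ)) ξ‖ := by
  have hp : 0 < ‖ξ‖ := by linarith
  rw [norm_jap, neg_div, Real.rpow_neg (by positivity), ← div_eq_mul_inv, inv_eq_one_div,
    div_le_div_iff₀ (by positivity) (by positivity), one_mul]
  calc (1 + ‖ξ‖ ^ 2) ^ ((q:ℝ) / 2) ≤ (2 * ‖ξ‖ ^ 2) ^ ((q:ℝ) / 2) := by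
        gcongr; nlinarith
    _ = 2 ^ ((q:ℝ) / 2) * ‖ξ‖ ^ q := by
      rw [Real.mul_rpow (by norm_num) (by positivity), ← Real.rpow_natCast ‖ξ‖ 2,
        ← Real.rpow_mul hp.le, ← Real.rpow_natCast ‖ξ‖ q]
      congr 2; push_cast; ring

/-- A family of symbols of order `-q` at high frequencies, uniformly for `|z| ≤ C`. -/
def HighBdd (q : ℕ) (C : ℝ) (m : ℂ → R3 → ℂ) : Prop :=
  ∃ A : ℝ, 0 ≤ A ∧ ∀ z : ℂ, ‖z‖ ≤ C → ∀ ξ : R3, C + 1 ≤ ‖ξ‖ → ‖m z ξ‖ ≤ A * ‖jap (-(q:ℝ)) ξ‖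

theorem highBdd_of_le {q : ℕ} {C : ℝ} (hC : 0 ≤ C) {m : ℂ → R3 → ℂ} {K : ℝ} (hK : 0 ≤ K)
    (h : ∀ z : ℂ, ‖z‖ ≤ C → ∀ ξ : R3, C + 1 ≤ ‖ξ‖ → ‖m z ξ‖ ≤ K * (‖ξ‖ ^ q)⁻¹) :
    HighBdd q C m := by
  refine ⟨K * 2 ^ ((q:ℝ) / 2), by positivity, fun z hz ξ hξ => (h z hz ξ hξ).trans ?_⟩
  rw [mul_assoc]
  gcongr
  exact inv_pow_le_norm_jap q (by linarith)

theorem highBdd_offSym {C : ℝ} (hC : 0 ≤ C) (n : ℕ) : HighBdd (n + 2) C (offSym n) := by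
  obtain ⟨K, hK, h⟩ := exists_norm_powSym_le hC (n + 1)
  exact highBdd_of_le hC hK h

theorem highBdd_diagSym {C : ℝ} (hC : 0 ≤ C) (n : ℕ) : HighBdd (n + 1) C (diagSym n) := by
  obtain ⟨K, hK, h⟩ := exists_norm_powSym_le hC (n + 1)
  obtain ⟨K', hK', h'⟩ := exists_norm_powSym_le hC n
  refine highBdd_of_le hC (K := K' + C * K) (by positivity) fun z hz ξ hξ => ?_
  have hp1 : 1 ≤ ‖ξ‖ := by linarith
  have i2 : ‖powSym (n + 1) (lamSq ξ) z‖ ≤ K * (‖ξ‖ ^ (n + 1))⁻¹ := by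
    refine (h z hz ξ hξ).trans ?_
    gcongr
    omega
  refine (norm_add_le _ _).trans ?_
  rw [add_mul, norm_mul, mul_assoc]
  gcongr
  exact h' z hz ξ hξ

theorem highBdd_lamSq_mul_offSym {C : ℝ} (hC : 0 ≤ C) (n : ℕ) :
    HighBdd n C (fun z => lamSq * offSym n z) := by
  obtain ⟨K, hK, h⟩ := exists_norm_powSym_le hC (n + 1)
  refine highBdd_of_le hC (K := 4 * Real.pi ^ 2 * K) (by positivity) fun z hz ξ hξ => ?_
  have hp : 0 < ‖ξ‖ := by linarith
  have h1 : ‖lamSq ξ‖ = 4 * Real.pi ^ 2 * ‖ξ‖ ^ 2 := by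
    rw [lamSq_eq, Complex.norm_real, Real.norm_of_nonneg (by positivity)]
  rw [Pi.mul_apply, norm_mul, h1]
  calc _ ≤ 4 * Real.pi ^ 2 * ‖ξ‖ ^ 2 * (K * (‖ξ‖ ^ (n + 1 + 1))⁻¹) := by
        gcongr; exact h z hz ξ hξ
    _ = _ := by
      rw [show n + 1 + 1 = n + 2 from rfl, pow_add]
      field_simp

/-- The bounds between weighted Sobolev spaces, uniformly in the spectral parameter. -/
theorem LowBdd.exists_nm_sobolev_le {a C : ℝ} (ha : 0 < a) (hC : 0 ≤ C) {m : ℂ → R3 → ℂ} {q : ℕ}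
    (hl : LowBdd a C m) (hh : HighBdd q C m) (s t : ℝ) (ht : t = s + q) :
    ∃ M : ℝ, 0 ≤ M ∧ ∀ z : ℂ, z.im ≠ 0 → ‖z‖ ≤ C → ∀ f,
      nm (multOp (jap t) (mulOp (jap (-a)) (multOp (m z) (mulOp (jap (-a))
        (multOp (jap (-s)) f))))) ≤ M * nm f := by
  obtain ⟨hm, A, hA, hl⟩ := hl
  obtain ⟨A', hA', hh⟩ := hh
  obtain ⟨B, hB, h⟩ := FreeWave.exists_nm_sobolev_le (C + 1) (by linarith) a ha s q
  refine ⟨B * max A A', by positivity, fun z hz hzC f => ?_⟩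
  rw [ht]
  refine h (m z) (hm z hz) (max A A') (by positivity) (fun ξ hξ => ?_) (fun f => ?_) f
  · refine (hh z hzC ξ hξ).trans ?_
    gcongr
    exact le_max_right _ _
  · refine (hl z hz hzC f).trans ?_
    have := nm_nonneg f
    gcongr
    exact le_max_left _ _

/-! ### The free resolvent as a matrix of Fourier multipliers -/

/-- The Fourier multiplier with symbol `g` on tempered distributions. -/
abbrev distMult (g : R3 → ℂ) : Dist →L[ℂ] Dist := TemperedDistribution.fourierMultiplierCLM ℂ g

theorem distMult_distMult {g h : R3 → ℂ} (hg : g.HasTemperateGrowth) (hh : h.HasTemperateGrowth)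
    (f : Dist) : distMult g (distMult h f) = distMult (g * h) f := by
  rw [mul_comm g h]
  exact TemperedDistribution.fourierMultiplierCLM_fourierMultiplierCLM_apply hh hg f

theorem distMult_add {g h : R3 → ℂ} (hg : g.HasTemperateGrowth) (hh : h.HasTemperateGrowth)
    (f : Dist) : distMult (g + h) f = distMult g f + distMult h f := by
  simp only [distMult, TemperedDistribution.fourierMultiplierCLM_apply,
    TemperedDistribution.smulLeftCLM_add hg hh, add_apply,
    FourierTransform.fourierInv_add]

theorem distMult_const (c : ℂ) (f : Dist) : distMult (fun _ => c) f = c • f := by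
  simp [distMult]

theorem distMult_one (f : Dist) : distMult 1 f = f :=
  (distMult_const 1 f).trans (one_smul ℂ f)

theorem distMult_zero (f : Dist) : distMult 0 f = 0 :=
  (distMult_const 0 f).trans (zero_smul ℂ f)

/-- The operator matrix `(d, i o; -i λ² o, d)` of Fourier multipliers. -/
def matOp (d o : R3 → ℂ) : Dist × Dist →L[ℂ] Dist × Dist :=
  ((distMult d).comp (ContinuousLinearMap.fst ℂ Dist Dist) +
    Complex.I • (distMult o).comp (ContinuousLinearMap.snd ℂ Dist Dist)).prod
  (-(Complex.I • (distMult (lamSq * o)).comp (ContinuousLinearMap.fst ℂ Dist Dist)) +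
    (distMult d).comp (ContinuousLinearMap.snd ℂ Dist Dist))

theorem matOp_apply (d o : R3 → ℂ) (u : Dist × Dist) : matOp d o u =
    (distMult d u.1 + Complex.I • distMult o u.2,
      -(Complex.I • distMult (lamSq * o) u.1) + distMult d u.2) := rfl

/-- Reads as `(d + o G0)(d' + o' G0)` with `G0² = λ²`, where `G0` commutes with scalar multipliers.
-/
theorem matOp_mul {d o d' o' : R3 → ℂ} (hd : d.HasTemperateGrowth) (ho : o.HasTemperateGrowth)
    (hd' : d'.HasTemperateGrowth) (ho' : o'.HasTemperateGrowth) :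
    matOp d o * matOp d' o' = matOp (d * d' + lamSq * o * o') (d * o' + o * d') := by
  have hl := hasTemperateGrowth_lamSq
  have e1 : ∀ f, distMult (d * d' + lamSq * o * o') f =
      distMult (d * d') f + distMult (lamSq * o * o') f :=
    distMult_add (hd.mul hd') ((hl.mul ho).mul ho')
  have e2 : ∀ f, distMult (d * o' + o * d') f = distMult (d * o') f + distMult (o * d') f :=
    distMult_add (hd.mul ho') (ho.mul hd')
  have e3 : ∀ f, distMult (lamSq * (d * o' + o * d')) f =
      distMult (lamSq * d * o') f + distMult (lamSq * o * d') f := fun f => by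
    rw [← distMult_add ((hl.mul hd).mul ho') ((hl.mul ho).mul hd')]
    congr 2; ring
  have c1 : ∀ f, distMult o (distMult (lamSq * o') f) = distMult (lamSq * o * o') f := fun f => by
    rw [distMult_distMult ho (hl.mul ho')]; congr 2; ring
  have c2 : ∀ f, distMult d (distMult (lamSq * o') f) = distMult (lamSq * d * o') f := fun f => by
    rw [distMult_distMult hd (hl.mul ho')]; congr 2; ring
  have I2 : ∀ f : Dist, Complex.I • Complex.I • f = -f := fun f => by
    rw [smul_smul, Complex.I_mul_I, neg_one_smul]
  refine ContinuousLinearMap.ext fun u => ?_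
  rw [mul_apply_eq_comp, matOp_apply, matOp_apply, matOp_apply]
  simp only [map_add, map_neg, map_smul, e1, e2, e3, c1, c2, distMult_distMult hd hd',
    distMult_distMult hd ho', distMult_distMult ho hd', distMult_distMult (hl.mul ho) ho',
    distMult_distMult (hl.mul ho) hd', smul_add, smul_neg, I2]
  refine Prod.ext ?_ ?_ <;> simp only <;> abel

theorem matOp_one : matOp 1 0 = 1 := by
  refine ContinuousLinearMap.ext fun u => ?_
  have hI : Complex.I • (0 : Dist) = 0 := by
    ext φ; exact mul_zero _
  rw [matOp_apply, mul_zero, distMult_one, distMult_one, distMult_zero, distMult_zero, hI, add_zero,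
    neg_zero, zero_add]
  rfl

theorem G0_sub_smul_one (z : ℂ) :
    G0 - z • (1 : Dist × Dist →L[ℂ] Dist × Dist) = matOp (fun _ => -z) 1 := by
  refine ContinuousLinearMap.ext fun u => ?_
  have hl : ∀ f : Dist, Laplacian.laplacian f = -distMult (lamSq * 1) f := by
    intro f
    rw [TemperedDistribution.laplacian_eq_fourierMultiplierCLM]
    have : lamSq * 1 = ((4 * Real.pi ^ 2 : ℝ) : ℂ) • fun ξ : R3 => ((‖ξ‖ ^ 2 : ℝ) : ℂ) := by
      ext ξ; simp [lamSq_eq]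
    rw [this, distMult, TemperedDistribution.fourierMultiplierCLM_smul (by fun_prop)]
    rw [smul_apply, ← neg_smul, ← Complex.ofReal_neg, Complex.coe_smul]
    congr 1; ring
  rw [matOp_apply]
  refine Prod.ext ?_ ?_
  · simp [G0, distMult_one]; abel
  · simp [G0, hl]; abel

/-- With `offSym_mul_add`, this is the even and odd part in `λ` of `(λ-z)^{-(n+1)} (λ-z)^{-1} =
(λ-z)^{-(n+2)}`. -/
theorem diagSym_mul_add {z : ℂ} (hz : z.im ≠ 0) (n : ℕ) :
    diagSym n z * diagSym 0 z + lamSq * offSym n z * offSym 0 z = diagSym (n + 1) z := by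
  ext ξ
  have h := lamSq_sub_ne_zero hz ξ
  simp only [Pi.add_apply, Pi.mul_apply, diagSym, offSym, powSym]
  field_simp
  ring

theorem offSym_mul_add {z : ℂ} (hz : z.im ≠ 0) (n : ℕ) :
    diagSym n z * offSym 0 z + offSym n z * diagSym 0 z = offSym (n + 1) z := by
  ext ξ
  have h := lamSq_sub_ne_zero hz ξ
  simp only [Pi.add_apply, Pi.mul_apply, diagSym, offSym, powSym]
  field_simp
  ring

theorem matOp_mul_matOp_symbol {z : ℂ} (hz : z.im ≠ 0) :
    matOp (fun _ => -z) 1 * matOp (diagSym 0 z) (offSym 0 z) = 1 := by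
  rw [matOp_mul (by fun_prop) (by exact .const 1) (hasTemperateGrowth_diagSym 0 hz)
    (hasTemperateGrowth_offSym 0 hz), ← matOp_one]
  congr 1 <;> ext ξ <;> have h := lamSq_sub_ne_zero hz ξ <;>
  simp only [Pi.add_apply, Pi.mul_apply, diagSym, offSym, powSym, Pi.one_apply, Pi.zero_apply] <;>
  field_simp <;> ring

theorem matOp_symbol_mul_matOp {z : ℂ} (hz : z.im ≠ 0) :
    matOp (diagSym 0 z) (offSym 0 z) * matOp (fun _ => -z) 1 = 1 := by
  rw [matOp_mul (hasTemperateGrowth_diagSym 0 hz) (hasTemperateGrowth_offSym 0 hz) (by fun_prop)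
    (by exact .const 1), ← matOp_one]
  congr 1 <;> ext ξ <;> have h := lamSq_sub_ne_zero hz ξ <;>
  simp only [Pi.add_apply, Pi.mul_apply, diagSym, offSym, powSym, Pi.one_apply, Pi.zero_apply] <;>
  field_simp <;> ring

/-- `G₀ - z` as a unit of the algebra of operators on pairs of tempered distributions. -/
def G0Unit {z : ℂ} (hz : z.im ≠ 0) : (Dist × Dist →L[ℂ] Dist × Dist)ˣ where
  val := G0 - z • (1 : Dist × Dist →L[ℂ] Dist × Dist)
  inv := matOp (diagSym 0 z) (offSym 0 z)
  val_inv := by rw [G0_sub_smul_one, matOp_mul_matOp_symbol hz]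
  inv_val := by rw [G0_sub_smul_one, matOp_symbol_mul_matOp hz]

theorem freeResolvent_eq {z : ℂ} (hz : z.im ≠ 0) :
    freeResolvent z = matOp (diagSym 0 z) (offSym 0 z) :=
  Ring.inverse_unit (G0Unit hz)

theorem freeResolvent_pow {z : ℂ} (hz : z.im ≠ 0) (n : ℕ) :
    freeResolvent z ^ (n + 1) = matOp (diagSym n z) (offSym n z) := by
  induction n with
  | zero => rw [zero_add, pow_one, freeResolvent_eq hz]
  | succ n ih =>
    rw [pow_succ, ih, freeResolvent_eq hz, matOp_mul (hasTemperateGrowth_diagSym n hz)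
      (hasTemperateGrowth_offSym n hz) (hasTemperateGrowth_diagSym 0 hz)
      (hasTemperateGrowth_offSym 0 hz), diagSym_mul_add hz, offSym_mul_add hz]

/-! ### Extension to Sobolev spaces -/

/-- The embedding of Schwartz functions into tempered distributions. -/
abbrev toDist : 𝓢(R3, ℂ) →L[ℂ] Dist := SchwartzMap.toTemperedDistributionCLM R3 ℂ volume

/-- The embedding of `L²` into tempered distributions. -/
abbrev L2toDist : Lp ℂ 2 (volume : Measure R3) →L[ℂ] Dist :=
  Lp.toTemperedDistributionCLM ℂ (volume : Measure R3) 2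

/-- Multiplication of a tempered distribution by `g`. -/
abbrev distMul (g : R3 → ℂ) : Dist →L[ℂ] Dist := TemperedDistribution.smulLeftCLM ℂ g

theorem distMult_toDist {g : R3 → ℂ} (hg : g.HasTemperateGrowth) (f : 𝓢(R3, ℂ)) :
    distMult g (toDist f) = toDist (multOp g f) :=
  TemperedDistribution.fourierMultiplierCLM_toTemperedDistributionCLM_eq hg f

theorem distMul_toDist {g : R3 → ℂ} (hg : g.HasTemperateGrowth) (f : 𝓢(R3, ℂ)) :
    distMul g (toDist f) = toDist (mulOp g f) := by
  ext u
  rw [TemperedDistribution.smulLeftCLM_apply_apply]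
  refine (SchwartzMap.toTemperedDistributionCLM_apply_apply _ _ _).trans
    (Eq.trans ?_ (SchwartzMap.toTemperedDistributionCLM_apply_apply _ _ _).symm)
  refine integral_congr_ae (.of_forall fun x => ?_)
  simp only [SchwartzMap.smulLeftCLM_apply_apply hg, smul_eq_mul]
  ring

/-- An operator on tempered distributions that is `L²`-bounded on Schwartz functions restricts to
a bounded operator on `L²`. -/
theorem exists_L2_operator {T : Dist →L[ℂ] Dist} {T₀ : 𝓢(R3, ℂ) →L[ℂ] 𝓢(R3, ℂ)} {M : ℝ}
    (hM : 0 ≤ M) (hT : ∀ f, T (toDist f) = toDist (T₀ f)) (h : ∀ f, nm (T₀ f) ≤ M * nm f) :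
    ∃ S : Lp ℂ 2 (volume : Measure R3) →L[ℂ] Lp ℂ 2 (volume : Measure R3), ‖S‖ ≤ M ∧
      ∀ u, L2toDist (S u) = T (L2toDist u) := by
  let e := SchwartzMap.toLpCLM ℂ ℂ 2 (volume : Measure R3)
  have hd : DenseRange e := SchwartzMap.denseRange_toLpCLM ENNReal.ofNat_ne_top
  let S := ((e.comp T₀).toLinearMap).extendOfNorm e.toLinearMap
  have hS : ∀ f, S (e f) = e (T₀ f) := fun f => LinearMap.extendOfNorm_eq hd ⟨M, h⟩ f
  refine ⟨S, LinearMap.opNorm_extendOfNorm_le hd hM h, fun u => ?_⟩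
  -- Both sides are continuous from `L²` to tempered distributions and agree on the dense Schwartz
  -- functions.
  have hc := hd.equalizer (g := fun u => L2toDist (S u)) (h := fun u => T (L2toDist u))
    (L2toDist.continuous.comp S.continuous) (T.continuous.comp L2toDist.continuous) ?_
  · exact congrFun hc u
  · ext1 f
    have h1 : ∀ f, L2toDist (e f) = toDist f := fun f => Lp.toTemperedDistribution_toLp_eq f
    simp only [Function.comp_apply]
    rw [hS, h1, h1, hT]

/-- The isometry `⟨D⟩^s` from `H^s` onto `L²`. -/
def sobolevEquiv (s : ℝ) : SobolevSpace s ≃ₗᵢ[ℂ] Lp ℂ 2 (volume : Measure R3) where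
  toLinearEquiv := LinearEquiv.ofBijective (SobolevSpace.toL2 s) ⟨SobolevSpace.toL2_injective s, by
    intro u
    have hu : besselPotential R3 ℂ s (besselPotential R3 ℂ (-s) (L2toDist u)) = L2toDist u := by
      simp
    refine ⟨⟨besselPotential R3 ℂ (-s) (L2toDist u), u, hu⟩, toDist_injective ?_⟩
    exact (SobolevSpace.besselFun_spec _).trans hu⟩
  norm_map' _ := rfl

theorem L2toDist_sobolevEquiv {s : ℝ} (f : SobolevSpace s) :
    L2toDist (sobolevEquiv s f) = distMult (jap s) (SobolevSpace.incl s f) :=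
  SobolevSpace.besselFun_spec f

theorem distMult_jap_neg_jap (s : ℝ) (f : Dist) :
    distMult (jap (-s)) (distMult (jap s) f) = f := by
  rw [distMult_distMult (by fun_prop) (by fun_prop), jap_mul_jap, neg_add_cancel, jap_zero]
  exact distMult_one f

/-- Conjugation by the isometries `⟨D⟩^s` and `⟨D⟩^t` onto `L²` reduces this to the Schwartz
estimate; norms are preserved exactly, so `M` stays independent of `z`. -/
theorem LowBdd.exists_sobolev_operator {a C : ℝ} (ha : 0 < a) (hC : 0 ≤ C) {m : ℂ → R3 → ℂ} {q : ℕ}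
    (hl : LowBdd a C m) (hh : HighBdd q C m) (s t : ℝ) (ht : t = s + q) :
    ∃ M : ℝ, 0 ≤ M ∧ ∀ z : ℂ, z.im ≠ 0 → ‖z‖ ≤ C →
      ∃ A : SobolevSpace s →L[ℂ] SobolevSpace t, ‖A‖ ≤ M ∧ ∀ u, SobolevSpace.incl t (A u) =
        distMul (jap (-a)) (distMult (m z) (distMul (jap (-a)) (SobolevSpace.incl s u))) := by
  obtain ⟨M, hM, h⟩ := hl.exists_nm_sobolev_le ha hC hh s t ht
  refine ⟨M, hM, fun z hz hzC => ?_⟩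
  have hm := hl.1 z hz
  let T : Dist →L[ℂ] Dist := (distMult (jap t)).comp ((distMul (jap (-a))).comp
    ((distMult (m z)).comp ((distMul (jap (-a))).comp (distMult (jap (-s))))))
  let T₀ : 𝓢(R3, ℂ) →L[ℂ] 𝓢(R3, ℂ) := (multOp (jap t)).comp ((mulOp (jap (-a))).comp
    ((multOp (m z)).comp ((mulOp (jap (-a))).comp (multOp (jap (-s))))))
  have hT : ∀ f, T (toDist f) = toDist (T₀ f) := fun f => by
    simp only [T, T₀, ContinuousLinearMap.comp_apply]
    rw [distMult_toDist (by fun_prop), distMul_toDist (by fun_prop), distMult_toDist hm,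
      distMul_toDist (by fun_prop), distMult_toDist (by fun_prop)]
  obtain ⟨S, hS, hSu⟩ := exists_L2_operator hM hT (h z hz hzC)
  refine ⟨((sobolevEquiv t).symm.toContinuousLinearEquiv : _ →L[ℂ] SobolevSpace t).comp
    (S.comp ((sobolevEquiv s).toContinuousLinearEquiv : SobolevSpace s →L[ℂ] _)), ?_, fun u => ?_⟩
  · refine ContinuousLinearMap.opNorm_le_bound _ hM fun u => ?_
    calc _ = ‖S (sobolevEquiv s u)‖ := (sobolevEquiv t).symm.norm_map _
      _ ≤ M * ‖sobolevEquiv s u‖ := S.le_of_opNorm_le hS _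
      _ = _ := by rw [LinearIsometryEquiv.norm_map]
  · rw [← distMult_jap_neg_jap t (SobolevSpace.incl t _), ← L2toDist_sobolevEquiv]
    have : ∀ v, sobolevEquiv t ((sobolevEquiv t).symm v) = v := (sobolevEquiv t).apply_symm_apply
    change distMult (jap (-t)) (L2toDist (sobolevEquiv t ((sobolevEquiv t).symm
      (S (sobolevEquiv s u))))) = _
    rw [this, hSu, L2toDist_sobolevEquiv]
    simp only [T, ContinuousLinearMap.comp_apply]
    rw [distMult_jap_neg_jap, distMult_jap_neg_jap]

/-! ### Assembly of the matrix entries -/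

theorem weight_apply (a : ℝ) (u : Dist × Dist) :
    weight a u = (distMul (jap a) u.1, distMul (jap a) u.2) := rfl

theorem one_lt_kappa_add {ε : ℝ} (hε : 0 < ε) (n : ℕ) : 1 < kappa (n + 1) + ε := by
  rcases n with _ | n
  · simp [kappa, hε]
  · have : (0:ℝ) ≤ n := n.cast_nonneg
    simp only [kappa, Nat.add_eq_right, Nat.add_eq_zero_iff, one_ne_zero, and_false, if_false]
    push_cast; linarith

theorem add_half_lt_kappa_add {ε : ℝ} (hε : 0 < ε) (n : ℕ) :
    (n : ℝ) + 1 / 2 < kappa (n + 1) + ε := by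
  rcases n with _ | n
  · simp [kappa]; linarith
  · simp only [kappa, Nat.add_eq_right, Nat.add_eq_zero_iff, one_ne_zero, and_false, if_false]
    push_cast; linarith

/-- A matrix of bounded operators acts on the Hilbert sum of two spaces. -/
theorem exists_prod_operator {E E' F F' : Type*} [NormedAddCommGroup E] [NormedSpace ℂ E]
    [NormedAddCommGroup E'] [NormedSpace ℂ E'] [NormedAddCommGroup F] [NormedSpace ℂ F]
    [NormedAddCommGroup F'] [NormedSpace ℂ F'] {M M' N N' : ℝ}
    {A : E →L[ℂ] F} {B : E' →L[ℂ] F} {A' : E →L[ℂ] F'} {B' : E' →L[ℂ] F'}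
    (hA : ‖A‖ ≤ M) (hB : ‖B‖ ≤ N) (hA' : ‖A'‖ ≤ M') (hB' : ‖B'‖ ≤ N') :
    ∃ T : WithLp 2 (E × E') →L[ℂ] WithLp 2 (F × F'), ‖T‖ ≤ (M + N) + (M' + N') ∧
      ∀ u, (T u).fst = A u.fst + B u.snd ∧ (T u).snd = A' u.fst + B' u.snd := by
  let e := WithLp.prodContinuousLinearEquiv 2 ℂ E E'
  let e' := WithLp.prodContinuousLinearEquiv 2 ℂ F F'
  let T : WithLp 2 (E × E') →L[ℂ] WithLp 2 (F × F') :=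
    (e'.symm : F × F' →L[ℂ] _).comp (((A.coprod B).prod (A'.coprod B')).comp (e : _ →L[ℂ] E × E'))
  have hT : ∀ u, (T u).fst = A u.fst + B u.snd ∧ (T u).snd = A' u.fst + B' u.snd :=
    fun u => ⟨rfl, rfl⟩
  refine ⟨T, ?_, hT⟩
  have := (norm_nonneg _).trans hA
  have := (norm_nonneg _).trans hB
  have := (norm_nonneg _).trans hA'
  have := (norm_nonneg _).trans hB'
  refine T.opNorm_le_bound (by positivity) fun u => ?_
  have h1 : ‖u.fst‖ ≤ ‖u‖ := WithLp.norm_fst_le E u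
  have h2 : ‖u.snd‖ ≤ ‖u‖ := WithLp.norm_snd_le E u
  have h3 : ‖T u‖ ≤ ‖(T u).fst‖ + ‖(T u).snd‖ := by
    rw [WithLp.prod_norm_eq_of_L2]
    refine Real.sqrt_le_iff.2 ⟨by positivity, ?_⟩
    nlinarith [norm_nonneg (T u).fst, norm_nonneg (T u).snd]
  rw [(hT u).1, (hT u).2] at h3
  calc ‖T u‖ ≤ (‖A u.fst‖ + ‖B u.snd‖) + (‖A' u.fst‖ + ‖B' u.snd‖) :=
        h3.trans (add_le_add (norm_add_le _ _) (norm_add_le _ _))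
    _ ≤ (M * ‖u‖ + N * ‖u‖) + (M' * ‖u‖ + N' * ‖u‖) := by
        gcongr
        · exact (A.le_of_opNorm_le hA _).trans (by gcongr)
        · exact (B.le_of_opNorm_le hB _).trans (by gcongr)
        · exact (A'.le_of_opNorm_le hA' _).trans (by gcongr)
        · exact (B'.le_of_opNorm_le hB' _).trans (by gcongr)
    _ = _ := by ring

/-- Uniform bounds for the weighted powers of the free resolvent. -/
theorem exists_weighted_resolvent_pow_bound (n : ℕ) (s t a C : ℝ) (hC : 0 ≤ C) (ha : 1 < a)
    (han : (n : ℝ) + 1 / 2 < a) (ht : t = s + (n + 1)) :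
    ∃ M : ℝ, ∀ z : ℂ, z.im ≠ 0 → ‖z‖ ≤ C → ∃ T : HSpace s →L[ℂ] HSpace t,
      (∀ u, HSpace.incl t (T u) =
        weight (-a) ((freeResolvent z ^ (n + 1)) (weight (-a) (HSpace.incl s u)))) ∧ ‖T‖ ≤ M := by
  have ha0 : 0 < a := by linarith
  -- The first components have one order more than the second, so the diagonal entries must gain `n
  -- + 1`, the upper right one `n + 2` and the lower left one only `n`, matching the decay of the
  -- three symbols.
  obtain ⟨M₁, -, h₁⟩ := (lowBdd_diagSym hC n ha han).exists_sobolev_operator ha0 hC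
    (highBdd_diagSym hC n) (s + 1) (t + 1) (by rw [ht]; push_cast; ring)
  obtain ⟨M₂, -, h₂⟩ := (lowBdd_offSym n ha han).exists_sobolev_operator ha0 hC
    (highBdd_offSym hC n) s (t + 1) (by rw [ht]; push_cast; ring)
  obtain ⟨M₃, -, h₃⟩ := (lowBdd_lamSq_mul_offSym hC n ha han).exists_sobolev_operator ha0 hC
    (highBdd_lamSq_mul_offSym hC n) (s + 1) t (by rw [ht]; ring)
  obtain ⟨M₄, -, h₄⟩ := (lowBdd_diagSym hC n ha han).exists_sobolev_operator ha0 hC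
    (highBdd_diagSym hC n) s t (by rw [ht]; push_cast; ring)
  refine ⟨(M₁ + M₂) + (M₃ + M₄), fun z hz hzC => ?_⟩
  obtain ⟨A₁, hA₁, e₁⟩ := h₁ z hz hzC
  obtain ⟨A₂, hA₂, e₂⟩ := h₂ z hz hzC
  obtain ⟨A₃, hA₃, e₃⟩ := h₃ z hz hzC
  obtain ⟨A₄, hA₄, e₄⟩ := h₄ z hz hzC
  obtain ⟨T, hT, hTu⟩ := exists_prod_operator (A := A₁) (B := Complex.I • A₂)
    (A' := -(Complex.I • A₃)) (B' := A₄) (N := M₂) (M' := M₃) hA₁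
    (by rwa [norm_smul, Complex.norm_I, one_mul])
    (by rwa [norm_neg, norm_smul, Complex.norm_I, one_mul]) hA₄
  refine ⟨T, fun u => ?_, hT⟩
  rw [freeResolvent_pow hz, weight_apply, weight_apply, matOp_apply, HSpace.incl, (hTu u).1,
    (hTu u).2]
  simp only [map_add, map_neg, map_smul, neg_apply,
    smul_apply, e₁, e₂, e₃, e₄, HSpace.incl]

end FreeWave

end

theorem mainTheorem6 (k : ℕ) (hk : 1 ≤ k) (s : ℝ) :
    (∀ z : ℂ, z.im ≠ 0 →
      IsUnit (FreeWave.G0 - z • (1 : FreeWave.Dist × FreeWave.Dist →L[ℂ]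
        FreeWave.Dist × FreeWave.Dist))) ∧
    ∀ C ε : ℝ, 0 < C → 0 < ε →
      ∃ M : ℝ, ∀ z : ℂ, z.im ≠ 0 → ‖z‖ ≤ C →
        ∃ T : FreeWave.HSpace s →L[ℂ] FreeWave.HSpace (s + (k : ℝ)),
          (∀ u : FreeWave.HSpace s,
            FreeWave.HSpace.incl (s + (k : ℝ)) (T u) =
              FreeWave.weight (-FreeWave.kappa k - ε)
                ((FreeWave.freeResolvent z ^ k)
                  (FreeWave.weight (-FreeWave.kappa k - ε) (FreeWave.HSpace.incl s u)))) ∧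
          ‖T‖ ≤ M := by
  -- The symbols are indexed by `n = k - 1`.
  obtain ⟨n, rfl⟩ := Nat.exists_eq_add_of_le' hk
  refine ⟨fun z hz => (FreeWave.G0Unit hz).isUnit, fun C ε hC hε => ?_⟩
  obtain ⟨M, hM⟩ := FreeWave.exists_weighted_resolvent_pow_bound n s (s + ((n + 1 : ℕ) : ℝ))
    (FreeWave.kappa (n + 1) + ε) C hC.le (FreeWave.one_lt_kappa_add hε n)
    (FreeWave.add_half_lt_kappa_add hε n) (by push_cast; ring)
  rw [neg_add'] at hM
  exact ⟨M, hM⟩
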